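/- **Conventions.** A (normalized) 4-IET $T$ consists of a permutation $\pi$ of $\{1,2,3,4\}$ and a length vector $L(T)=(l_1,\dots,l_4)$ with $l_i\ge 0$, $\sum l_i=1$; it exchanges $I_j=[\sum_{k<j}l_k,\sum_{k\le j}l_k)$ by $Tx=x-\sum_{k<j}l_k+\sum_{\pi(k)<\pi(j)}l_k$ for $x\in I_j$. It is uniquely ergodic if it has exactly one invariant Borel probability measure on $[0,1)$. A permutation is denoted by the list of values of $\pi^{-1}$. Put $n=4$, $p=\pi^{-1}(n)$. The first step of Rauzy induction fails if $l_n=l_p$ (the *fail plane*); it is of kind $a$ if $l_n<l_p$ and of kind $b$ if $l_n>l_p$. A step of kind $a$ gives $\pi'(j)=\pi(j)$ for $j\le p$, $\pi'(p+1)=\pi(n)$, $\pi'(j)=\pi(j-1)$ for $j>p+1$, and the lengths $l_j$ ($j<p$), $l_p-l_n$ ($j=p$), $l_n$ ($j=p+1$), $l_{j-1}$ ($j>p+1$). A step of kind $b$ gives $\pi'(j)=\pi(j)$ if $\pi(j)\le\pi(n)$, $\pi'(j)=\pi(j)+1$ if $\pi(n)<\pi(j)<n$, $\pi'(j)=\pi(n)+1$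 if $\pi(j)=n$, and replaces $l_n$ by $l_n-l_p$. Its matrix expresses the old lengths through the new ones; the matrix $M(w)$ of a word $w$ of steps is the product of the step matrices. Length vectors are taken up to positive scaling. The Rauzy class of $(4321)$ is the set of permutations reachable from it by such steps. **Building blocks.** A building block is a triple $b=(T_1,F,T_2)$ of uniquely ergodic 4-IETs with the same permutation $\pi$ such that $F$ lies on the fail plane; $T_1,T_2$ are its endpoints. A block $b'=(S_1,G,S_2)$ is *left compatible* with $b$, with matrix $M(w)$, if for some word $w$ of $k\ge1$ steps leading from $\pi$ to the permutation of $b'$: every point strictly between $T_1$ and $F$ has Rauzy induction defined for $k$ steps and follows $w$; $S_1=R^k(T_1)$ (performed formally along $w$ where Rauzy induction of $T_1$ fails); and $L(F)=M(w)L(S_2)$. *Right compatible* is the same with $T_1,S_1$ interchanged with $T_2,S_2$. A building block sequence $b_1\to\dots\to b_m$ is a finite sequence in which each $b_{i+1}$ is left or right compatible with $b_i$; its matrix $M(b_1\to\dots\to b_m)$ is the product of the matrices of its steps, and its depth is the number of times the direction (left/right) of consecutive steps changes. A loop $P=b_1\to\dots\to b_k$ ($k\ge 1$) is a sequence such that $b_1$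 is compatible with $b_k$; its depth and its matrix $M(P)$ are those of the closed sequence $b_1\to\dots\to b_k\to b_1$. It is minimal if the $b_i$ are pairwise distinct. A sequence $c_1\to c_2\to c_3$, with $c_1$ compatible with $b_k$, *leaves* $P$ if it does not contain as an initial segment $P$, or any $Q$ such that $P$ is the concatenation of several copies of $Q$, and is not an initial segment of $P$. **Matrices.** In a $4\times4$ matrix $M$ with nonnegative integer entries, column $i$ is added to column $j$ if $M_{ij}>0$. $M$ is *combining* if there are disjoint groups of active and passive columns such that there are at least two active columns; at most one column is in neither group; only active columns are added to other columns; each active column is added to all other active columns; and each passive column has an active column added to it. A column $i$ of a combining matrix is *idle* if it is neither active nor passive (for any admissible choice of the groups). $M$ is *almost positive* if it has $\tau>1$ rows with all entries positive and each other row has exactly one entry $1$ and all other entries $0$. **Proposition.** There is a finite set $\mathcal B$ of building blocks with the following properties. * *Transitivity.* For every permutation $\pi$ in the Rauzy class of $(4321)$ there is a block in $\mathcal B$ with permutation $\pi$ whose endpoints lie strictly on different sides of the fail plane. * *Completeness.* For every block in $\mathcal B$ there are a left compatible and a right compatible block in $\mathcal B$. * *Combining Loops.* If $P$ is a minimal loop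 of depth $0$ formed from blocks in $\mathcal B$, then $M(P)$ is combining. * *Isolated Idle.* If $P$ is a loop of depth $0$ formed from blocks in $\mathcal B$ such that $M(P)$ has an idle column, then for every sequence $c_1\to c_2\to c_3$ formed from blocks in $\mathcal B$ that leaves $P$, each column of $M(P\to c_1\to c_2\to c_3)$ has at least two nonzero entries. * *Almost Positivity.* There is a number $c\ge0$ such that every building block sequence formed from blocks in $\mathcal B$ of depth at least $c$ has an initial segment of depth at most $c$ whose matrix is almost positive. -/

import Mathlib

open scoped Matrix

/-! ### Interval exchange transformations -/

/-- A normalized `d`-interval exchange transformation: a permutation `π` of the `d` intervals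
(`π j` is the position of the `j`-th interval after the exchange) and a vector of nonnegative
lengths of total length one. Intervals of length zero are allowed. -/
@[ext]
structure IET (d : ℕ) where
  perm : Equiv.Perm (Fin d)
  len : Fin d → ℝ
  len_nonneg : ∀ i, 0 ≤ len i
  len_sum : ∑ i, len i = 1

namespace IET

variable {d : ℕ}

/-- The left end of the `j`-th interval. -/
def start (T : IET d) (j : Fin d) : ℝ := ∑ k with k < j, T.len k

/-- The `j`-th interval `I_j`. -/
def interval (T : IET d) (j : Fin d) : Set ℝ := Set.Ico (T.start j) (T.start j + T.len j)

open Classical in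
/-- The exchange map: `T x = x - ∑_{k < j} l_k + ∑_{π k < π j} l_k` for `x` in `I_j`.
The intervals are disjoint, so at most one summand is active; points outside `[0, 1)` are fixed. -/
noncomputable def map (T : IET d) (x : ℝ) : ℝ :=
  x + ∑ j, if x ∈ T.interval j then (∑ k with T.perm k < T.perm j, T.len k) - T.start j else 0

/-- `T` has exactly one invariant Borel probability measure on `[0, 1)`. -/
def UniquelyErgodic (T : IET d) : Prop :=
  ∃! μ : MeasureTheory.Measure ℝ, MeasureTheory.IsProbabilityMeasure μ ∧
    μ (Set.Ico 0 1)ᶜ = 0 ∧ MeasureTheory.MeasurePreserving T.map μ μ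

end IET

/-! ### Rauzy induction for four intervals -/

/-- The two kinds of Rauzy steps. -/
inductive RauzyKind
  | a
  | b
  deriving DecidableEq

namespace Rauzy

/-- The index `p = π⁻¹(n)` of the interval that is rightmost after the exchange. -/
def crit (π : Equiv.Perm (Fin 4)) : Fin 4 := π.symm 3

/-- The permutation fixing `j ≤ p`, sending `p + 1` to the last index and `j` to `j - 1`
for `j > p + 1`. -/
def shift (p : Fin 4) : Equiv.Perm (Fin 4) where
  toFun j := if j ≤ p then j else if j = p + 1 then 3 else j - 1
  invFun j := if j ≤ p then j else if j = 3 then p + 1 else j + 1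
  left_inv := by revert p; decide
  right_inv := by revert p; decide

/-- The permutation after one Rauzy step:
* kind `a`: `π' j = π j` for `j ≤ p`, `π' (p + 1) = π n`, and `π' j = π (j - 1)` otherwise;
* kind `b`: `π' j = π j` if `π j ≤ π n`, `π' j = π j + 1` if `π n < π j < n`, and
  `π' j = π n + 1` if `π j = n`. -/
def move : RauzyKind → Equiv.Perm (Fin 4) → Equiv.Perm (Fin 4)
  | .a, π => π * shift (crit π)
  | .b, π => (shift (π 3)).symm * π

/-- The permutation after a finite sequence of Rauzy steps. -/
def moves : List RauzyKind → Equiv.Perm (Fin 4) → Equiv.Perm (Fin 4)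
  | [], π => π
  | t :: w, π => moves w (move t π)

/-- The matrix of one Rauzy step (old lengths in terms of new lengths). -/
def stepMatrix : RauzyKind → Equiv.Perm (Fin 4) → Matrix (Fin 4) (Fin 4) ℕ
  | .a, π => Matrix.of fun i j =>
      if j ≤ crit π then (if i = j then 1 else 0)
      else if i = 3 then (if crit π + 1 = j then 1 else 0)
      else (if i = j - 1 then 1 else 0)
  | .b, π => Matrix.of fun i j =>
      if i = 3 ∧ j = crit π then 1 else if i = j then 1 else 0

/-- The Rauzy matrix of a finite Rauzy path. -/
def pathMatrix : List RauzyKind → Equiv.Perm (Fin 4) → Matrix (Fin 4) (Fin 4) ℕ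
  | [], _ => 1
  | t :: w, π => stepMatrix t π * pathMatrix w (move t π)

/-- The unnormalized length vector after one Rauzy step of the given kind. -/
def stepLen : RauzyKind → Equiv.Perm (Fin 4) → (Fin 4 → ℝ) → Fin 4 → ℝ
  | .a, π, l => fun j =>
      if j < crit π then l j
      else if j = crit π then l j - l 3
      else if j = crit π + 1 then l 3
      else l (j - 1)
  | .b, π, l => fun j => if j = 3 then l 3 - l (crit π) else l j

/-- The unnormalized length vector after formally performing a sequence of Rauzy steps. -/
def pathLen : List RauzyKind → Equiv.Perm (Fin 4) → (Fin 4 → ℝ) → Fin 4 → ℝ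
  | [], _, l => l
  | t :: w, π, l => pathLen w (move t π) (stepLen t π l)

/-- Rauzy induction is defined at `(π, l)` and its first step has the given kind: kind `a` means
that the last interval is shorter than the interval that becomes last, kind `b` the opposite. -/
def FirstKind : RauzyKind → Equiv.Perm (Fin 4) → (Fin 4 → ℝ) → Prop
  | .a, π, l => l 3 < l (crit π)
  | .b, π, l => l (crit π) < l 3

/-- The first steps of Rauzy induction of `(π, l)` are defined and are given by the word `w`. -/
def Follows : List RauzyKind → Equiv.Perm (Fin 4) → (Fin 4 → ℝ) → Prop
  | [], _, _ => True
  | t :: w, π, l => FirstKind t π l ∧ Follows w (move t π) (stepLen t π l)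

/-- Sanity check: the old lengths are the step matrix applied to the new lengths. -/
theorem stepMatrix_mulVec_stepLen (t : RauzyKind) (π : Equiv.Perm (Fin 4)) (l : Fin 4 → ℝ)
    (h : crit π ≠ 3) :
    ((stepMatrix t π).map (Nat.cast : ℕ → ℝ)) *ᵥ stepLen t π l = l := by
  have key : ∀ p : Fin 4, p ≠ 3 → p = 0 ∨ p = 1 ∨ p = 2 := by decide
  funext i
  rcases key _ h with hp | hp | hp <;> cases t <;> fin_cases i <;>
    simp [Matrix.mulVec, dotProduct, Fin.sum_univ_four, stepMatrix, stepLen, hp]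

/-- The Rauzy class of the permutation `(4321)`. -/
def InClass4321 (π : Equiv.Perm (Fin 4)) : Prop :=
  Relation.ReflTransGen (fun σ τ => ∃ t, τ = move t σ) Fin.revPerm π

/-- The signed distance to the plane on which the first Rauzy step fails. -/
def failValue (T : IET 4) : ℝ := T.len 3 - T.len (crit T.perm)

end Rauzy

/-! ### Building blocks -/

/-- A building block `(T₁, F, T₂)`. -/
@[ext]
structure BuildingBlock where
  left : IET 4
  mid : IET 4
  right : IET 4
  left_perm : left.perm = mid.perm
  right_perm : right.perm = mid.perm
  left_ue : left.UniquelyErgodic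
  mid_ue : mid.UniquelyErgodic
  right_ue : right.UniquelyErgodic
  mid_fail : Rauzy.failValue mid = 0

/-- The two directions, left and right. -/
inductive Side
  | L
  | R
  deriving DecidableEq

/-- The opposite direction. -/
def Side.opp : Side → Side
  | .L => .R
  | .R => .L

namespace BuildingBlock

/-- The common permutation of the three transformations. -/
def perm (b : BuildingBlock) : Equiv.Perm (Fin 4) := b.mid.perm

/-- The left or right endpoint of a building block. -/
def endpoint (b : BuildingBlock) : Side → IET 4
  | .L => b.left
  | .R => b.right

/-- `b'` is left (`s = L`) or right (`s = R`) compatible with `b` through the `k ≥ 1` Rauzy steps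
listed in `w`. For `s = L`, with `b = (T₁, F, T₂)` and `b' = (S₁, G, S₂)`:
* all points strictly between `T₁` and `F` have Rauzy induction defined for `k` steps, with
  steps `w`;
* `S₁ = R^k(T₁)` after normalization, where at `T₁` (a limit of points that follow `w`) the steps
  `w` are used;
* `L(F) = M(w) L(S₂)` after normalization. -/
def Compatible (s : Side) (w : List RauzyKind) (b b' : BuildingBlock) : Prop :=
  w ≠ [] ∧
  b'.perm = Rauzy.moves w b.perm ∧
  (∀ t : ℝ, 0 < t → t < 1 →
    Rauzy.Follows w b.perm ((1 - t) • (b.endpoint s).len + t • b.mid.len)) ∧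
  (∃ c : ℝ, 0 < c ∧ Rauzy.pathLen w b.perm (b.endpoint s).len = c • (b'.endpoint s).len) ∧
  (∃ c : ℝ, 0 < c ∧
    b.mid.len = c • (((Rauzy.pathMatrix w b.perm).map (Nat.cast : ℕ → ℝ)) *ᵥ
      (b'.endpoint s.opp).len))

end BuildingBlock

/-! ### Building block sequences -/

/-- One step `→ b'` of a building block sequence: its direction, the Rauzy steps realizing the
compatibility, and the next building block. -/
structure BlockStep where
  side : Side
  word : List RauzyKind
  next : BuildingBlock

/-- `b → s₁.next → s₂.next → ⋯` is a building block sequence formed by elements of `B`. -/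
def IsBlockSeq (B : Set BuildingBlock) : BuildingBlock → List BlockStep → Prop
  | b, [] => b ∈ B
  | b, s :: r => b ∈ B ∧ b.Compatible s.side s.word s.next ∧ IsBlockSeq B s.next r

/-- The Rauzy matrix of a building block sequence. -/
def seqMatrix : BuildingBlock → List BlockStep → Matrix (Fin 4) (Fin 4) ℕ
  | _, [] => 1
  | b, s :: r => Rauzy.pathMatrix s.word b.perm * seqMatrix s.next r

/-- The number of times a direction sequence swaps. -/
def swaps : List Side → ℕ
  | [] => 0
  | [_] => 0
  | s :: s' :: r => (if s = s' then 0 else 1) + swaps (s' :: r)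

/-- The depth of a building block sequence with the given steps. -/
def seqDepth (r : List BlockStep) : ℕ := swaps (r.map BlockStep.side)

/-- A building block loop `b₁ → ⋯ → bₖ`, given as the closed sequence `b₁ → ⋯ → bₖ → b₁`
with first block `b` and steps `r`. Its depth is `seqDepth r`, its matrix is `seqMatrix b r`. -/
def IsBlockLoop (B : Set BuildingBlock) (b : BuildingBlock) (r : List BlockStep) : Prop :=
  IsBlockSeq B b r ∧ ∃ s, r.getLast? = some s ∧ s.next = b

/-- The blocks `b₁, …, bₖ` of the loop `b₁ → ⋯ → bₖ → b₁`. -/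
def loopBlocks (b : BuildingBlock) (r : List BlockStep) : List BuildingBlock :=
  b :: r.dropLast.map BlockStep.next

/-- A sequence with blocks `c` leaves the loop with blocks `P`: it does not contain `P` as an
initial segment, nor a shorter loop that `P` runs around several times, and it is not an initial
segment of `P`. If the blocks of `P` are distinct, then `Q = P` is the only case. -/
def LeavesLoop (P c : List BuildingBlock) : Prop :=
  (∀ (Q : List BuildingBlock) (m : ℕ), P = (List.replicate m Q).flatten → ¬ Q <+: c) ∧ ¬ c <+: P

/-! ### Matrix properties -/

namespace Matrix4

/-- `A` and `P` are admissible groups of active and passive columns of `M`. Column `i` is added to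
column `j` if the entry `M i j` is positive. -/
structure IsGrouping (M : Matrix (Fin 4) (Fin 4) ℕ) (A P : Finset (Fin 4)) : Prop where
  disjoint : Disjoint A P
  two_le : 2 ≤ A.card
  idle_le : (A ∪ P)ᶜ.card ≤ 1
  only_active : ∀ i j, i ≠ j → 0 < M i j → i ∈ A
  active_active : ∀ i ∈ A, ∀ j ∈ A, i ≠ j → 0 < M i j
  passive : ∀ j ∈ P, ∃ i ∈ A, 0 < M i j

/-- Combining matrices. -/
def IsCombining (M : Matrix (Fin 4) (Fin 4) ℕ) : Prop := ∃ A P, IsGrouping M A P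

/-- The column `i` of the combining matrix `M` is idle: it can be neither active nor passive. -/
def IsIdle (M : Matrix (Fin 4) (Fin 4) ℕ) (i : Fin 4) : Prop :=
  IsCombining M ∧ ∀ A P, IsGrouping M A P → i ∉ A ∧ i ∉ P

/-- At least two rows have only positive entries, the other rows are rows of the identity. -/
def AlmostPositive (M : Matrix (Fin 4) (Fin 4) ℕ) : Prop :=
  ∃ S : Finset (Fin 4), 1 < S.card ∧ (∀ i ∈ S, ∀ j, 0 < M i j) ∧
    ∀ i ∉ S, ∃ j, M i j = 1 ∧ ∀ j', j' ≠ j → M i j' = 0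

end Matrix4

/-! ### The five properties -/

/-- Transitivity. -/
def Transitivity (B : Set BuildingBlock) : Prop :=
  ∀ π, Rauzy.InClass4321 π → ∃ b ∈ B, b.perm = π ∧
    Rauzy.failValue b.left * Rauzy.failValue b.right < 0

/-- Completeness. -/
def Completeness (B : Set BuildingBlock) : Prop :=
  ∀ b ∈ B, ∀ s : Side, ∃ b' ∈ B, ∃ w, b.Compatible s w b'

/-- Combining Loops. -/
def CombiningLoops (B : Set BuildingBlock) : Prop :=
  ∀ b r, IsBlockLoop B b r → seqDepth r = 0 → (loopBlocks b r).Nodup →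
    Matrix4.IsCombining (seqMatrix b r)

/-- Isolated Idle: here `P` is the loop `b₁ → ⋯ → bₖ → b₁` given by `b` and `r`, and
`P → c₁ → c₂ → c₃` is the sequence with steps `r.dropLast ++ [s₁, s₂, s₃]`. -/
def IsolatedIdle (B : Set BuildingBlock) : Prop :=
  ∀ b r, IsBlockLoop B b r → seqDepth r = 0 → (∃ i, Matrix4.IsIdle (seqMatrix b r) i) →
    ∀ s₁ s₂ s₃ : BlockStep, IsBlockSeq B b (r.dropLast ++ [s₁, s₂, s₃]) →
      LeavesLoop (loopBlocks b r) [s₁.next, s₂.next, s₃.next] →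
      ∀ j, 2 ≤ (Finset.univ.filter fun i =>
        seqMatrix b (r.dropLast ++ [s₁, s₂, s₃]) i j ≠ 0).card

/-- Almost Positivity. -/
def AlmostPositivity (B : Set BuildingBlock) : Prop :=
  ∃ c : ℕ, ∀ b r, IsBlockSeq B b r → c ≤ seqDepth r →
    ∃ r', r' <+: r ∧ seqDepth r' ≤ c ∧ Matrix4.AlmostPositive (seqMatrix b r')

/-!
A block has a left and a right half, and the halves of the blocks of a sequence are subdivided again
and again. The proof gives an explicit set of eighteen blocks, `block i` for `i : Fin 18`, that is
closed under this subdivision.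

All transformations involved are rotations with lengths in the ring `ℤ[φ]` of the golden ratio. Both
endpoints of each block have only two intervals of positive length, in the ratio `φ`; Rauzy induction
permutes finitely many such transformations up to scaling. The middle points are chosen on the fail
plane such that they are rotations too and fall into the same finite set as soon as Rauzy induction
is continued past the fail plane. Unique ergodicity is that of an irrational rotation of the circle
(`IET.uniquelyErgodic_of_displacement`).

The endpoints of each block lie strictly on different sides of the fail plane. Hence the words and
the targets of compatibility are forced (`BuildingBlock.Compatible.unique`): a half of a block
follows the word `nextWord s i` until the fail plane separates the images of its ends, and then it
spans the block `next s i`. Block sequences are therefore walks in a finite graph with two outgoing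
edges at each vertex (`eq_walk_of_isBlockSeq`), and all five properties become statements about
the matrices `nextMatrix s i` along such walks.

* The loops of depth zero are the cycles of `next .L` and `next .R`. They have length at most two,
  and all but two of them have matrices without idle column, a property that passes to powers
  (`Matrix4.IsFull`). The two exceptions are fixed points, for which the walks that leave them are
  checked one by one.
* For almost positivity, each row of the matrix of a walk is followed separately. It starts as a row
  of the identity. When it has ceased to be one, its support grows until it is full, which takes at
  most six changes of direction (`IsGrown.vecMul_pos`). After two changes of direction at least two
  rows are not rows of the identity any more (`exists_not_isUnitRow`). So every six changes of
  direction either another row ceases to be a row of the identity, or the matrix is almost positive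
  (`exists_almostPositive_mul`).
-/

/-! ### Interval exchanges acting as irrational rotations are uniquely ergodic -/

open MeasureTheory in
/-- An irrational rotation of the circle has only one invariant probability measure: such a measure
is invariant under a dense set of translations, hence, by continuity, under all of them. -/
theorem AddCircle.eq_haar_of_map_add_eq {α : ℝ} (hα : Irrational α)
    (ν : Measure (AddCircle (1 : ℝ))) [IsProbabilityMeasure ν]
    (h : ν.map (fun y => (α : AddCircle (1 : ℝ)) + y) = ν) :
    ν = AddCircle.haarAddCircle := by
  have hstep (f : BoundedContinuousFunction (AddCircle (1 : ℝ)) ℝ) (t : AddCircle (1 : ℝ)) :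
      ∫ y, f ((t + α) + y) ∂ν = ∫ y, f (t + y) ∂ν := by
    conv_rhs => rw [← h]
    rw [integral_map (by fun_prop) (by fun_prop)]
    simp only [add_assoc]
  have hinv (t : AddCircle (1 : ℝ)) (f : BoundedContinuousFunction (AddCircle (1 : ℝ)) ℝ) :
      ∫ y, f (t + y) ∂ν = ∫ y, f y ∂ν := by
    have hz (k : ℤ) (t : AddCircle (1 : ℝ)) :
        ∫ y, f ((t + k • (α : AddCircle (1 : ℝ))) + y) ∂ν = ∫ y, f (t + y) ∂ν := by
      induction k generalizing t with
      | zero => simp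
      | succ n ih =>
        rw [add_zsmul, one_zsmul, ← add_assoc, hstep, ih]
      | pred n ih =>
        rw [← ih t, ← hstep f (t + _ • _), sub_zsmul, one_zsmul, add_assoc t, neg_add_cancel_right]
    have hd : DenseRange fun k : ℤ => k • (α : AddCircle (1 : ℝ)) :=
      AddCircle.denseRange_zsmul_coe_iff.2 (by simpa using hα)
    have hc : Continuous fun t : AddCircle (1 : ℝ) => ∫ y, f (t + y) ∂ν :=
      continuous_of_dominated (bound := fun _ => ‖f‖)
        (fun t => by fun_prop) (fun t => .of_forall fun y => f.norm_coe_le_norm _)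
        (integrable_const _) (.of_forall fun y => by fun_prop)
    have heq : (fun t : AddCircle (1 : ℝ) => ∫ y, f (t + y) ∂ν) = fun _ => ∫ y, f y ∂ν :=
      hd.equalizer hc continuous_const (funext fun k => by simpa using hz k 0)
    exact congrFun heq t
  have : ν.IsAddLeftInvariant := ⟨fun t => by
    have : IsProbabilityMeasure (ν.map (t + ·)) :=
      Measure.isProbabilityMeasure_map (by fun_prop)
    refine ext_of_forall_integral_eq_of_IsFiniteMeasure fun f => ?_
    rw [integral_map (by fun_prop) (by fun_prop)]
    exact hinv t f⟩
  have : ν.IsAddHaarMeasure :=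
    Measure.isAddHaarMeasure_of_isCompact_nonempty_interior ν Set.univ isCompact_univ
      (by simp) (by simp) (by simp)
  exact Measure.isAddHaarMeasure_eq_of_isProbabilityMeasure _ _

namespace IET

variable {d : ℕ}

/-- The left end of the image of the `j`-th interval. -/
def imageStart (T : IET d) (j : Fin d) : ℝ := ∑ k with T.perm k < T.perm j, T.len k

/-- The displacement of the points of the `j`-th interval. -/
def displacement (T : IET d) (j : Fin d) : ℝ := T.imageStart j - T.start j

theorem start_add_len (T : IET d) (j : Fin d) : T.start j + T.len j = ∑ k with k ≤ j, T.len k := by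
  have : ({k | k ≤ j} : Finset (Fin d)) = insert j ({k | k < j} : Finset (Fin d)) := by
    ext k; simp [le_iff_lt_or_eq, or_comm]
  rw [this, Finset.sum_insert (by simp), start, add_comm]

theorem start_add_len_le_start (T : IET d) {i j : Fin d} (h : i < j) :
    T.start i + T.len i ≤ T.start j := by
  rw [start_add_len, start]
  exact Finset.sum_le_sum_of_subset_of_nonneg
    (fun k hk => by simp at hk ⊢; exact hk.trans_lt h) fun k _ _ => T.len_nonneg k

theorem exists_mem_interval (T : IET d) {x : ℝ} (hx : x ∈ Set.Ico (0 : ℝ) 1) :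
    ∃ j, x ∈ T.interval j := by
  obtain _ | n := d
  · simpa using T.len_sum
  have hne : (Finset.univ.filter fun j => x < T.start j + T.len j).Nonempty := by
    refine ⟨Fin.last n, ?_⟩
    simpa [start_add_len, Fin.le_last, T.len_sum] using hx.2
  obtain ⟨j, hj⟩ := Finset.exists_minimal hne
  simp only [minimal_iff_forall_lt, Finset.mem_filter, Finset.mem_univ, true_and, not_lt] at hj
  refine ⟨j, ?_, hj.1⟩
  induction j using Fin.cases with
  | zero => simpa [start] using hx.1
  | succ i =>
    refine le_of_eq_of_le ?_ (hj.2 (Fin.castSucc_lt_succ (i := i)))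
    rw [start_add_len, start]
    congr 1
    ext k
    simp [Fin.lt_def, Fin.le_def]

theorem map_of_mem_interval (T : IET d) {x : ℝ} {j : Fin d} (h : x ∈ T.interval j) :
    T.map x = x + T.displacement j := by
  rw [map, Finset.sum_eq_single j]
  · simp [h, displacement, imageStart]
  · intro i _ hij
    refine if_neg fun hi => ?_
    rcases lt_or_gt_of_ne hij with hlt | hlt
    · exact absurd (hi.2.trans_le (T.start_add_len_le_start hlt)) (not_lt.2 h.1)
    · exact absurd (h.2.trans_le (T.start_add_len_le_start hlt)) (not_lt.2 hi.1)
  · simp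

theorem map_mem_Ico (T : IET d) {x : ℝ} (hx : x ∈ Set.Ico (0 : ℝ) 1) :
    T.map x ∈ Set.Ico (0 : ℝ) 1 := by
  obtain ⟨j, hj⟩ := T.exists_mem_interval hx
  have h0 : 0 ≤ T.imageStart j := Finset.sum_nonneg fun k _ => T.len_nonneg k
  have h1 : T.imageStart j + T.len j ≤ 1 := by
    rw [imageStart, add_comm, ← Finset.sum_insert (by simp), ← T.len_sum]
    exact Finset.sum_le_sum_of_subset_of_nonneg (Finset.subset_univ _) fun k _ _ => T.len_nonneg k
  rw [T.map_of_mem_interval hj, displacement]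
  have := hj.1
  have := hj.2
  constructor <;> linarith

theorem measurable_map (T : IET d) : Measurable T.map := by
  classical
  unfold map
  refine measurable_id.add (Finset.measurable_sum _ fun j _ => ?_)
  exact Measurable.ite measurableSet_Ico measurable_const measurable_const

/-- If all intervals of positive length are displaced by `α` modulo one, then the interval exchange
is the rotation of the circle by `α`. -/
theorem coe_map_eq_add (T : IET d) {α : ℝ}
    (h : ∀ j, T.len j = 0 ∨ T.displacement j = α ∨ T.displacement j = α - 1) {x : ℝ}
    (hx : x ∈ Set.Ico (0 : ℝ) 1) :
    ((T.map x : ℝ) : AddCircle (1 : ℝ)) = (α : AddCircle (1 : ℝ)) + (x : AddCircle (1 : ℝ)) := by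
  obtain ⟨j, hj⟩ := T.exists_mem_interval hx
  rw [T.map_of_mem_interval hj, add_comm x, AddCircle.coe_add]
  rcases h j with h0 | h1 | h1
  · have := hj.1.trans_lt hj.2
    simp [h0] at this
  · rw [h1]
  · have h2 : ((1 : ℝ) : AddCircle (1 : ℝ)) = 0 := AddCircle.coe_period 1
    rw [h1, AddCircle.coe_sub, h2, sub_zero]

open MeasureTheory in
/-- An interval exchange that acts as an irrational rotation is uniquely ergodic. -/
theorem uniquelyErgodic_of_displacement (T : IET d) {α : ℝ} (hα : Irrational α)
    (h : ∀ j, T.len j = 0 ∨ T.displacement j = α ∨ T.displacement j = α - 1) :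
    T.UniquelyErgodic := by
  -- `σ` sends a point of the circle to its representative in `[0, 1)`.
  set σ : AddCircle (1 : ℝ) → ℝ := fun y => (AddCircle.measurableEquivIco 1 0 y : ℝ) with hσ
  have σm : Measurable σ :=
    measurable_subtype_coe.comp (AddCircle.measurableEquivIco 1 0).measurable
  have σI (y) : σ y ∈ Set.Ico (0 : ℝ) 1 := by
    have := (AddCircle.measurableEquivIco 1 0 y).2
    simpa only [zero_add] using this
  have coeσ (y) : ((σ y : ℝ) : AddCircle (1 : ℝ)) = y := AddCircle.coe_equivIco (p := (1 : ℝ))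
  have hinj {x y : ℝ} (hx : x ∈ Set.Ico (0 : ℝ) 1) (hy : y ∈ Set.Ico (0 : ℝ) 1)
      (hxy : (x : AddCircle (1 : ℝ)) = y) : x = y :=
    (AddCircle.coe_eq_coe_iff_of_mem_Ico (p := (1 : ℝ)) (a := 0) (by simpa using hx)
      (by simpa using hy)).1 hxy
  have σcoe {x : ℝ} (hx : x ∈ Set.Ico (0 : ℝ) 1) : σ x = x := hinj (σI _) hx (coeσ _)
  have hconj (y) : T.map (σ y) = σ (α + y) :=
    hinj (T.map_mem_Ico (σI y)) (σI _) (by rw [T.coe_map_eq_add h (σI y), coeσ, coeσ])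
  have cm : Measurable ((↑) : ℝ → AddCircle (1 : ℝ)) := AddCircle.measurable_mk'
  refine ⟨AddCircle.haarAddCircle.map σ, ⟨Measure.isProbabilityMeasure_map σm.aemeasurable, ?_,
    T.measurable_map, ?_⟩, ?_⟩
  · rw [Measure.map_apply σm measurableSet_Ico.compl]
    convert measure_empty (μ := AddCircle.haarAddCircle (T := (1 : ℝ)))
    ext y
    simpa using σI y
  · rw [Measure.map_map T.measurable_map σm]
    have : T.map ∘ σ = σ ∘ fun y => (α : AddCircle (1 : ℝ)) + y := funext hconj
    rw [this, ← Measure.map_map σm (by fun_prop), map_add_left_eq_self]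
  · rintro ν ⟨hν, h0, hT⟩
    have hae : ∀ᵐ x ∂ν, x ∈ Set.Ico (0 : ℝ) 1 := h0
    have : IsProbabilityMeasure (ν.map ((↑) : ℝ → AddCircle (1 : ℝ))) :=
      Measure.isProbabilityMeasure_map cm.aemeasurable
    rw [← AddCircle.eq_haar_of_map_add_eq hα (ν.map ((↑) : ℝ → AddCircle (1 : ℝ))),
      Measure.map_map σm cm]
    · conv_lhs => rw [← Measure.map_id (μ := ν)]
      exact Measure.map_congr (hae.mono fun x hx => (σcoe hx).symm)
    · rw [Measure.map_map (by fun_prop) cm]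
      conv_rhs => rw [← hT.map_eq, Measure.map_map cm T.measurable_map]
      exact Measure.map_congr (hae.mono fun x hx => (T.coe_map_eq_add h hx).symm)

end IET

/-! ### Linearity and determinism of Rauzy induction -/

namespace Rauzy

/-- The signed distance of a length vector to the plane on which the first Rauzy step fails. -/
def gap (π : Equiv.Perm (Fin 4)) (l : Fin 4 → ℝ) : ℝ := l 3 - l (crit π)

theorem gap_add_smul (π : Equiv.Perm (Fin 4)) (x y : ℝ) (l m : Fin 4 → ℝ) :
    gap π (x • l + y • m) = x * gap π l + y * gap π m := by
  simp [gap]; ring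

theorem gap_smul (π : Equiv.Perm (Fin 4)) (x : ℝ) (l : Fin 4 → ℝ) :
    gap π (x • l) = x * gap π l := by
  simp [gap]; ring

theorem stepLen_add_smul (t : RauzyKind) (π : Equiv.Perm (Fin 4)) (x y : ℝ) (l m : Fin 4 → ℝ) :
    stepLen t π (x • l + y • m) = x • stepLen t π l + y • stepLen t π m := by
  funext j
  cases t <;> simp only [stepLen, Pi.add_apply, Pi.smul_apply, smul_eq_mul] <;> split_ifs <;> ring

theorem pathLen_add_smul (w : List RauzyKind) (π : Equiv.Perm (Fin 4)) (x y : ℝ)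
    (l m : Fin 4 → ℝ) :
    pathLen w π (x • l + y • m) = x • pathLen w π l + y • pathLen w π m := by
  induction w generalizing π l m with
  | nil => rfl
  | cons t w ih => simp only [pathLen, stepLen_add_smul, ih]

theorem pathLen_smul (w : List RauzyKind) (π : Equiv.Perm (Fin 4)) (x : ℝ) (l : Fin 4 → ℝ) :
    pathLen w π (x • l) = x • pathLen w π l := by
  simpa using pathLen_add_smul w π x 0 l l

theorem stepLen_stepMatrix_mulVec (t : RauzyKind) {π : Equiv.Perm (Fin 4)} (l : Fin 4 → ℝ)
    (h : crit π ≠ 3) :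
    stepLen t π (((stepMatrix t π).map (Nat.cast : ℕ → ℝ)) *ᵥ l) = l := by
  have key : ∀ p : Fin 4, p ≠ 3 → p = 0 ∨ p = 1 ∨ p = 2 := by decide
  funext i
  rcases key _ h with hp | hp | hp <;> cases t <;> fin_cases i <;>
    simp [Matrix.mulVec, dotProduct, Fin.sum_univ_four, stepMatrix, stepLen, hp]

theorem pathLen_pathMatrix_mulVec (w : List RauzyKind) {π : Equiv.Perm (Fin 4)} (l : Fin 4 → ℝ)
    (h : ∀ u, crit (moves u π) ≠ 3) :
    pathLen w π (((pathMatrix w π).map (Nat.cast : ℕ → ℝ)) *ᵥ l) = l := by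
  induction w generalizing π l with
  | nil => simp [pathLen, pathMatrix]
  | cons t w ih =>
    rw [pathLen, pathMatrix, ← Nat.coe_castRingHom, Matrix.map_mul, ← Matrix.mulVec_mulVec,
      Nat.coe_castRingHom, stepLen_stepMatrix_mulVec t (π := π) _ (h []), ih _ fun u => h (t :: u)]

theorem pathMatrix_mulVec_pathLen (w : List RauzyKind) {π : Equiv.Perm (Fin 4)} (l : Fin 4 → ℝ)
    (h : ∀ u, crit (moves u π) ≠ 3) :
    ((pathMatrix w π).map (Nat.cast : ℕ → ℝ)) *ᵥ pathLen w π l = l := by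
  induction w generalizing π l with
  | nil => simp [pathLen, pathMatrix]
  | cons t w ih =>
    rw [pathLen, pathMatrix, ← Nat.coe_castRingHom, Matrix.map_mul, ← Matrix.mulVec_mulVec,
      Nat.coe_castRingHom, ih _ fun u => h (t :: u), stepMatrix_mulVec_stepLen t π l (h [])]

/-- All points strictly between `l` and `m` follow the word `w`. -/
def SegmentFollows (w : List RauzyKind) (π : Equiv.Perm (Fin 4)) (l m : Fin 4 → ℝ) : Prop :=
  ∀ t : ℝ, 0 < t → t < 1 → Follows w π ((1 - t) • l + t • m)

theorem SegmentFollows.tail {t : RauzyKind} {w : List RauzyKind} {π : Equiv.Perm (Fin 4)}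
    {l m : Fin 4 → ℝ} (h : SegmentFollows (t :: w) π l m) :
    SegmentFollows w (move t π) (stepLen t π l) (stepLen t π m) := fun x h0 h1 => by
  have := (h x h0 h1).2
  rwa [stepLen_add_smul] at this

/-- A segment whose ends are strictly on different sides of the fail plane crosses it, so that
its points cannot all follow a nonempty word. -/
theorem SegmentFollows.eq_nil {w : List RauzyKind} {π : Equiv.Perm (Fin 4)}
    {l m : Fin 4 → ℝ} (h : SegmentFollows w π l m) (hs : gap π l * gap π m < 0) : w = [] := by
  obtain _ | ⟨t, w⟩ := w
  · rfl
  exfalso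
  obtain ⟨x, h0, h1, hx⟩ : ∃ x : ℝ, 0 < x ∧ x < 1 ∧ (1 - x) * gap π l + x * gap π m = 0 := by
    have hne : gap π l - gap π m ≠ 0 := fun h0 => by
      rw [sub_eq_zero.1 h0] at hs
      exact absurd (mul_self_nonneg _) (not_le.2 hs)
    refine ⟨gap π l / (gap π l - gap π m), ?_, ?_, by field_simp; ring⟩
    · rcases mul_neg_iff.1 hs with ⟨h1, h2⟩ | ⟨h1, h2⟩
      · exact div_pos h1 (by linarith)
      · exact div_pos_of_neg_of_neg h1 (by linarith)
    · rcases mul_neg_iff.1 hs with ⟨h1, h2⟩ | ⟨h1, h2⟩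
      · rw [div_lt_one (by linarith)]; linarith
      · rw [div_lt_one_of_neg (by linarith)]; linarith
  rw [← gap_add_smul, gap, sub_eq_zero] at hx
  have := (h x h0 h1).1
  cases t <;> simp only [FirstKind, hx, lt_irrefl] at this

/-- A segment determines the word that it follows until the fail plane separates the images of
its ends. -/
theorem SegmentFollows.unique {w w' : List RauzyKind} {π : Equiv.Perm (Fin 4)}
    {l m : Fin 4 → ℝ} (h : SegmentFollows w π l m) (h' : SegmentFollows w' π l m)
    (hs : gap (moves w π) (pathLen w π l) * gap (moves w π) (pathLen w π m) < 0)
    (hs' : gap (moves w' π) (pathLen w' π l) * gap (moves w' π) (pathLen w' π m) < 0) :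
    w = w' := by
  induction w generalizing w' π l m with
  | nil => exact (h'.eq_nil hs).symm
  | cons t w ih =>
    obtain _ | ⟨t', w'⟩ := w'
    · exact h.eq_nil hs'
    have ht : t = t' := by
      have h1 := (h (1 / 2) (by norm_num) (by norm_num)).1
      have h2 := (h' (1 / 2) (by norm_num) (by norm_num)).1
      cases t <;> cases t' <;> first | rfl | exact absurd h1 h2.asymm
    subst ht
    rw [ih h.tail h'.tail hs hs']

end Rauzy

namespace BuildingBlock

/-- The endpoints of the block lie strictly on different sides of the fail plane. -/
def Separated (b : BuildingBlock) : Prop :=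
  Rauzy.failValue b.left * Rauzy.failValue b.right < 0

theorem Separated.gap_mul_gap_neg {b : BuildingBlock} (h : b.Separated) (s : Side) :
    Rauzy.gap b.perm (b.endpoint s).len * Rauzy.gap b.perm (b.endpoint s.opp).len < 0 := by
  have h' := h
  rw [Separated, Rauzy.failValue, Rauzy.failValue, b.left_perm, b.right_perm] at h'
  cases s
  · exact h'
  · rw [mul_comm]; exact h'

theorem eq_of_smul_len_eq {d : ℕ} {S T : IET d} {c c' : ℝ} (hc' : 0 < c')
    (h : c • S.len = c' • T.len) : S.len = T.len := by
  have hs := congrArg (fun l => ∑ i, l i) h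
  simp only [Pi.smul_apply, smul_eq_mul, ← Finset.mul_sum, S.len_sum, T.len_sum, mul_one] at hs
  subst hs
  exact smul_right_injective _ hc'.ne' h

/-- A block has at most one left and one right compatible block with separated endpoints, up to
the choice of the middle point, and it is compatible with it through one word only. -/
theorem Compatible.unique {b b₁ b₂ : BuildingBlock} {s : Side} {w₁ w₂ : List RauzyKind}
    (hirr : ∀ u, Rauzy.crit (Rauzy.moves u b.perm) ≠ 3)
    (h₁ : b.Compatible s w₁ b₁) (h₂ : b.Compatible s w₂ b₂)
    (hs₁ : b₁.Separated) (hs₂ : b₂.Separated) :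
    w₁ = w₂ ∧ b₁.perm = b₂.perm ∧ b₁.left.len = b₂.left.len ∧ b₁.right.len = b₂.right.len := by
  have key {b' : BuildingBlock} {w : List RauzyKind} (h : b.Compatible s w b') :
      ∃ c : ℝ, 0 < c ∧ Rauzy.pathLen w b.perm b.mid.len = c • (b'.endpoint s.opp).len := by
    obtain ⟨-, -, -, -, c, hc, hm⟩ := h
    refine ⟨c, hc, ?_⟩
    rw [hm, Rauzy.pathLen_smul, Rauzy.pathLen_pathMatrix_mulVec _ _ hirr]
  have sep {b' : BuildingBlock} {w : List RauzyKind} (h : b.Compatible s w b')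
      (hs : b'.Separated) :
      Rauzy.gap (Rauzy.moves w b.perm) (Rauzy.pathLen w b.perm (b.endpoint s).len) *
        Rauzy.gap (Rauzy.moves w b.perm) (Rauzy.pathLen w b.perm b.mid.len) < 0 := by
    obtain ⟨c, hc, hm⟩ := key h
    obtain ⟨-, hp, -, ⟨c', hc', he⟩, -⟩ := h
    rw [hm, he, ← hp, Rauzy.gap_smul, Rauzy.gap_smul, mul_mul_mul_comm]
    exact mul_neg_of_pos_of_neg (mul_pos hc' hc) (hs.gap_mul_gap_neg s)
  obtain rfl : w₁ = w₂ :=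
    Rauzy.SegmentFollows.unique h₁.2.2.1 h₂.2.2.1 (sep h₁ hs₁) (sep h₂ hs₂)
  obtain ⟨c₁, hc₁, hm₁⟩ := key h₁
  obtain ⟨c₂, hc₂, hm₂⟩ := key h₂
  obtain ⟨-, hp₁, -, ⟨d₁, hd₁, he₁⟩, -⟩ := h₁
  obtain ⟨-, hp₂, -, ⟨d₂, hd₂, he₂⟩, -⟩ := h₂
  have e := eq_of_smul_len_eq hd₂ (he₁.symm.trans he₂)
  have m := eq_of_smul_len_eq hc₂ (hm₁.symm.trans hm₂)
  refine ⟨rfl, hp₁.trans hp₂.symm, ?_⟩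
  cases s
  · exact ⟨e, m⟩
  · exact ⟨m, e⟩

end BuildingBlock

/-! ### Exact arithmetic with golden integers -/

/-- The ring `ℤ[φ]` of golden integers, where `φ ^ 2 = 1 + φ`. -/
abbrev GoldenInt := QuadraticAlgebra ℤ 1 1

namespace GoldenInt

/-- The embedding of the golden integers into the reals that sends `φ` to the golden ratio. -/
noncomputable def toReal : GoldenInt →ₐ[ℤ] ℝ :=
  QuadraticAlgebra.lift ⟨Real.goldenRatio, by
    rw [← sq, Real.goldenRatio_sq]; simp [add_comm]⟩

theorem toReal_eq (x : GoldenInt) : toReal x = x.re + x.im * Real.goldenRatio := by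
  simp [toReal]

theorem toReal_eq_zero {x : GoldenInt} : toReal x = 0 ↔ x = 0 := by
  refine ⟨fun h => ?_, fun h => by rw [h, map_zero]⟩
  rw [toReal_eq] at h
  have him : x.im = 0 := by
    by_contra him
    exact ((Real.goldenRatio_irrational.intCast_mul him).intCast_add x.re).ne_int 0
      (by simpa using h)
  rw [him] at h
  exact QuadraticAlgebra.ext (by simpa using h) him

theorem toReal_injective : Function.Injective toReal :=
  (injective_iff_map_eq_zero toReal).2 fun _ => toReal_eq_zero.1

/-- A decidable condition that is sufficient for `toReal x` to be nonnegative: `φ ^ 10 * x` has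
nonnegative coefficients, where `φ ^ 10 = 34 + 55 * φ`. -/
def Nonneg (x : GoldenInt) : Prop := 0 ≤ (⟨34, 55⟩ * x).re ∧ 0 ≤ (⟨34, 55⟩ * x).im

instance (x : GoldenInt) : Decidable (Nonneg x) := inferInstanceAs (Decidable (_ ∧ _))

/-- A decidable condition that is sufficient for `toReal x` to be positive. -/
def Pos (x : GoldenInt) : Prop := Nonneg x ∧ x ≠ 0

instance (x : GoldenInt) : Decidable (Pos x) := inferInstanceAs (Decidable (_ ∧ _))

theorem Nonneg.toReal_nonneg {x : GoldenInt} (h : Nonneg x) : 0 ≤ toReal x := by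
  have hφ := Real.goldenRatio_pos
  have h1 : 0 ≤ toReal (⟨34, 55⟩ * x) := by
    rw [toReal_eq]
    have h2 : (0 : ℝ) ≤ (⟨34, 55⟩ * x : GoldenInt).re := by exact_mod_cast h.1
    have h3 : (0 : ℝ) ≤ (⟨34, 55⟩ * x : GoldenInt).im := by exact_mod_cast h.2
    positivity
  rw [map_mul] at h1
  refine nonneg_of_mul_nonneg_right h1 ?_
  rw [toReal_eq]
  push_cast
  positivity

theorem Pos.toReal_pos {x : GoldenInt} (h : Pos x) : 0 < toReal x :=
  lt_of_le_of_ne h.1.toReal_nonneg fun h0 => h.2 (toReal_eq_zero.1 h0.symm)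

theorem irrational_div {x y : GoldenInt} (h : x.re * y.im ≠ x.im * y.re) :
    Irrational (toReal x / toReal y) := by
  have hy : toReal y ≠ 0 := fun h0 => by
    rw [toReal_eq_zero] at h0
    simp [h0] at h
  rintro ⟨q, hq⟩
  have h1 : toReal ((q.den : GoldenInt) * x) = toReal ((q.num : GoldenInt) * y) := by
    have hd : (q.den : ℝ) ≠ 0 := by exact_mod_cast q.den_ne_zero
    rw [eq_div_iff hy, Rat.cast_def, div_mul_eq_mul_div, div_eq_iff hd] at hq
    rw [map_mul, map_mul, map_natCast, map_intCast, hq, mul_comm]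
  have h2 := toReal_injective h1
  have hre : (q.den : ℤ) * x.re = q.num * y.re := by simpa using congrArg QuadraticAlgebra.re h2
  have him : (q.den : ℤ) * x.im = q.num * y.im := by simpa using congrArg QuadraticAlgebra.im h2
  refine h (mul_left_cancel₀ (a := (q.den : ℤ)) (by exact_mod_cast q.den_ne_zero) ?_)
  linear_combination y.im * hre - y.re * him

/-- The real vector with the given golden coordinates. -/
noncomputable def toRealVec (v : Fin 4 → GoldenInt) : Fin 4 → ℝ := fun i => toReal (v i)

/-- `Rauzy.stepLen` for vectors of golden integers. -/
def stepLen : RauzyKind → Equiv.Perm (Fin 4) → (Fin 4 → GoldenInt) → Fin 4 → GoldenInt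
  | .a, π, l => fun j =>
      if j < Rauzy.crit π then l j
      else if j = Rauzy.crit π then l j - l 3
      else if j = Rauzy.crit π + 1 then l 3
      else l (j - 1)
  | .b, π, l => fun j => if j = 3 then l 3 - l (Rauzy.crit π) else l j

/-- `Rauzy.pathLen` for vectors of golden integers. -/
def pathLen : List RauzyKind → Equiv.Perm (Fin 4) → (Fin 4 → GoldenInt) → Fin 4 → GoldenInt
  | [], _, l => l
  | t :: w, π, l => pathLen w (Rauzy.move t π) (stepLen t π l)

/-- `Rauzy.gap` for vectors of golden integers. -/
def gap (π : Equiv.Perm (Fin 4)) (l : Fin 4 → GoldenInt) : GoldenInt := l 3 - l (Rauzy.crit π)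

theorem toRealVec_stepLen (t : RauzyKind) (π : Equiv.Perm (Fin 4)) (l : Fin 4 → GoldenInt) :
    toRealVec (stepLen t π l) = Rauzy.stepLen t π (toRealVec l) := by
  funext j
  cases t <;> simp only [toRealVec, stepLen, Rauzy.stepLen] <;> split_ifs <;> simp

theorem toRealVec_pathLen (w : List RauzyKind) (π : Equiv.Perm (Fin 4)) (l : Fin 4 → GoldenInt) :
    toRealVec (pathLen w π l) = Rauzy.pathLen w π (toRealVec l) := by
  induction w generalizing π l with
  | nil => rfl
  | cons t w ih => rw [pathLen, ih, toRealVec_stepLen, Rauzy.pathLen]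

theorem gap_toRealVec (π : Equiv.Perm (Fin 4)) (l : Fin 4 → GoldenInt) :
    Rauzy.gap π (toRealVec l) = toReal (gap π l) := by
  simp [Rauzy.gap, toRealVec, gap]

/-- `x` and `y` are nonnegative and not both zero. -/
def SomePos (x y : GoldenInt) : Prop := Nonneg x ∧ Nonneg y ∧ (x ≠ 0 ∨ y ≠ 0)

instance (x y : GoldenInt) : Decidable (SomePos x y) := inferInstanceAs (Decidable (_ ∧ _ ∧ _))

theorem SomePos.combination_pos {x y : GoldenInt} (h : SomePos x y) {r t : ℝ} (hr : 0 < r)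
    (ht : 0 < t) : 0 < r * toReal x + t * toReal y := by
  rcases h.2.2 with hx | hy
  · exact add_pos_of_pos_of_nonneg (mul_pos hr (Pos.toReal_pos ⟨h.1, hx⟩))
      (mul_nonneg ht.le h.2.1.toReal_nonneg)
  · exact add_pos_of_nonneg_of_pos (mul_nonneg hr.le h.1.toReal_nonneg)
      (mul_pos ht (Pos.toReal_pos ⟨h.2.1, hy⟩))

/-- A decidable condition that is sufficient for all points strictly between `l` and `m` to follow
a word: at each step both ends satisfy the defining inequality weakly, one of them strictly. -/
def SegmentFollows : List RauzyKind → Equiv.Perm (Fin 4) → (Fin 4 → GoldenInt) →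
    (Fin 4 → GoldenInt) → Prop
  | [], _, _, _ => True
  | .a :: w, π, l, m => SomePos (-gap π l) (-gap π m) ∧
      SegmentFollows w (Rauzy.move .a π) (stepLen .a π l) (stepLen .a π m)
  | .b :: w, π, l, m => SomePos (gap π l) (gap π m) ∧
      SegmentFollows w (Rauzy.move .b π) (stepLen .b π l) (stepLen .b π m)

instance decidableSegmentFollows : ∀ (w : List RauzyKind) (π : Equiv.Perm (Fin 4))
    (l m : Fin 4 → GoldenInt), Decidable (SegmentFollows w π l m)
  | [], _, _, _ => .isTrue trivial
  | .a :: w, _, _, _ =>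
    haveI := decidableSegmentFollows w
    inferInstanceAs (Decidable (_ ∧ _))
  | .b :: w, _, _, _ =>
    haveI := decidableSegmentFollows w
    inferInstanceAs (Decidable (_ ∧ _))

/-- The positive weights need not add up to one, so that `l` and `m` need not be normalized. -/
theorem SegmentFollows.follows {w : List RauzyKind} {π : Equiv.Perm (Fin 4)}
    {l m : Fin 4 → GoldenInt} (h : SegmentFollows w π l m) {r t : ℝ} (hr : 0 < r) (ht : 0 < t) :
    Rauzy.Follows w π (r • toRealVec l + t • toRealVec m) := by
  induction w generalizing π l m with
  | nil => trivial
  | cons k w ih =>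
    have hg := Rauzy.gap_add_smul π r t (toRealVec l) (toRealVec m)
    rw [gap_toRealVec, gap_toRealVec] at hg
    cases k
    · have h2 := h.1.combination_pos hr ht
      rw [map_neg, map_neg] at h2
      refine ⟨sub_neg.1 (show Rauzy.gap π _ < 0 by rw [hg]; linarith), ?_⟩
      rw [Rauzy.stepLen_add_smul, ← toRealVec_stepLen, ← toRealVec_stepLen]
      exact ih h.2
    · have h2 := h.1.combination_pos hr ht
      refine ⟨sub_pos.1 (show 0 < Rauzy.gap π _ by rw [hg]; linarith), ?_⟩
      rw [Rauzy.stepLen_add_smul, ← toRealVec_stepLen, ← toRealVec_stepLen]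
      exact ih h.2

/-- The vector has nonnegative coordinates, not all zero. -/
def IsLength (v : Fin 4 → GoldenInt) : Prop := (∀ i, Nonneg (v i)) ∧ Pos (∑ i, v i)

instance (v : Fin 4 → GoldenInt) : Decidable (IsLength v) := inferInstanceAs (Decidable (_ ∧ _))

/-- The interval exchange whose lengths are proportional to a golden vector. -/
noncomputable def iet (π : Equiv.Perm (Fin 4)) (v : Fin 4 → GoldenInt) (h : IsLength v) :
    IET 4 where
  perm := π
  len := (toReal (∑ i, v i))⁻¹ • toRealVec v
  len_nonneg i := mul_nonneg (inv_nonneg.2 h.2.toReal_pos.le) (h.1 i).toReal_nonneg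
  len_sum := by
    simp only [Pi.smul_apply, smul_eq_mul, ← Finset.mul_sum, toRealVec, ← map_sum]
    exact inv_mul_cancel₀ h.2.toReal_pos.ne'

/-- `IET.displacement` for vectors of golden integers. -/
def displacement (π : Equiv.Perm (Fin 4)) (v : Fin 4 → GoldenInt) (j : Fin 4) : GoldenInt :=
  ∑ k with π k < π j, v k - ∑ k with k < j, v k

/-- All intervals of positive length are displaced by the same number `α` modulo the total length,
and the ratio of `α` to the total length is irrational. -/
def IsRotation (π : Equiv.Perm (Fin 4)) (v : Fin 4 → GoldenInt) : Prop :=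
  ∃ i, (∀ j, v j = 0 ∨ displacement π v j = displacement π v i ∨
      displacement π v j = displacement π v i - ∑ k, v k) ∧
    (displacement π v i).re * (∑ k, v k).im ≠ (displacement π v i).im * (∑ k, v k).re

instance (π : Equiv.Perm (Fin 4)) (v : Fin 4 → GoldenInt) : Decidable (IsRotation π v) :=
  inferInstanceAs (Decidable (∃ _, _ ∧ _))

theorem IsRotation.uniquelyErgodic {π : Equiv.Perm (Fin 4)} {v : Fin 4 → GoldenInt}
    (hr : IsRotation π v) (h : IsLength v) : (iet π v h).UniquelyErgodic := by
  obtain ⟨i, hi, hirr⟩ := hr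
  have hS := h.2.toReal_pos.ne'
  have hd (j : Fin 4) : (iet π v h).displacement j =
      toReal (displacement π v j) / toReal (∑ k, v k) := by
    simp only [IET.displacement, IET.imageStart, IET.start, iet, Pi.smul_apply, smul_eq_mul,
      ← Finset.mul_sum, toRealVec, ← map_sum, displacement, map_sub]
    rw [div_eq_inv_mul, mul_sub]
    rfl
  refine IET.uniquelyErgodic_of_displacement _ (irrational_div hirr) fun j => ?_
  rw [hd]
  rcases hi j with h1 | h1 | h1
  · left
    simp [iet, toRealVec, h1]
  · right; left
    rw [h1]
  · right; right
    rw [h1, map_sub, sub_div, div_self hS]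

end GoldenInt

/-! ### The blocks -/

open GoldenInt

instance : Fintype Side := ⟨{.L, .R}, fun s => by cases s <;> decide⟩

instance : Fintype RauzyKind := ⟨{.a, .b}, fun t => by cases t <;> decide⟩

/-- Golden coordinates of a building block. Its permutation is given by a word of Rauzy steps that
leads to it from `(4321)`; the length vectors are given up to scaling. -/
structure BlockData where
  word : List RauzyKind
  left : Fin 4 → GoldenInt
  mid : Fin 4 → GoldenInt
  right : Fin 4 → GoldenInt

namespace BlockData

/-- The permutation of the block. -/
def perm (D : BlockData) : Equiv.Perm (Fin 4) := Rauzy.moves D.word Fin.revPerm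

/-- The length vector of the left or right endpoint. -/
def endpoint (D : BlockData) : Side → Fin 4 → GoldenInt
  | .L => D.left
  | .R => D.right

/-- The data define a building block whose endpoints are separated by the fail plane; the
lengths of the endpoints are normalized. -/
def Valid (D : BlockData) : Prop :=
  (IsLength D.left ∧ IsLength D.mid ∧ IsLength D.right) ∧
  (IsRotation D.perm D.left ∧ IsRotation D.perm D.mid ∧ IsRotation D.perm D.right) ∧
  gap D.perm D.mid = 0 ∧ Pos (-(gap D.perm D.left * gap D.perm D.right)) ∧
  ∀ s, ∑ i, D.endpoint s i = 1

/-- The building block with the given coordinates. -/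
noncomputable def toBlock (D : BlockData) (h : D.Valid) : BuildingBlock where
  left := iet D.perm D.left h.1.1
  mid := iet D.perm D.mid h.1.2.1
  right := iet D.perm D.right h.1.2.2
  left_perm := rfl
  right_perm := rfl
  left_ue := h.2.1.1.uniquelyErgodic _
  mid_ue := h.2.1.2.1.uniquelyErgodic _
  right_ue := h.2.1.2.2.uniquelyErgodic _
  mid_fail := by
    have h0 := h.2.2.1
    have : Rauzy.gap D.perm (toRealVec D.mid) = 0 := by rw [gap_toRealVec, h0, map_zero]
    change Rauzy.gap D.perm (_ • toRealVec D.mid) = 0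
    rw [Rauzy.gap_smul, this, mul_zero]

theorem endpoint_len (D : BlockData) (h : D.Valid) (s : Side) :
    ((D.toBlock h).endpoint s).len = toRealVec (D.endpoint s) := by
  have h1 := h.2.2.2.2 s
  cases s
  · change (toReal (∑ i, D.left i))⁻¹ • toRealVec D.left = _
    rw [show ∑ i, D.left i = 1 from h1, map_one, inv_one, one_smul]; rfl
  · change (toReal (∑ i, D.right i))⁻¹ • toRealVec D.right = _
    rw [show ∑ i, D.right i = 1 from h1, map_one, inv_one, one_smul]; rfl

theorem separated (D : BlockData) (h : D.Valid) : (D.toBlock h).Separated := by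
  have hL : (D.toBlock h).left.len = toRealVec D.left := D.endpoint_len h .L
  have hR : (D.toBlock h).right.len = toRealVec D.right := D.endpoint_len h .R
  have h1 := h.2.2.2.1.toReal_pos
  change Rauzy.gap D.perm (D.toBlock h).left.len * Rauzy.gap D.perm (D.toBlock h).right.len < 0
  rw [hL, hR, gap_toRealVec, gap_toRealVec, ← map_mul]
  simpa using h1

/-- The segment from the endpoint of `D` on the side `s` to the middle point of `D` is mapped by
the word `w` to the segment between the endpoints of `D'`. -/
def Leads (s : Side) (w : List RauzyKind) (D D' : BlockData) : Prop :=
  w ≠ [] ∧ D'.perm = Rauzy.moves w D.perm ∧ SegmentFollows w D.perm (D.endpoint s) D.mid ∧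
    (Pos (∑ i, pathLen w D.perm (D.endpoint s) i) ∧ ∀ i, pathLen w D.perm (D.endpoint s) i =
      (∑ k, pathLen w D.perm (D.endpoint s) k) * D'.endpoint s i) ∧
    Pos (∑ i, pathLen w D.perm D.mid i) ∧ ∀ i, pathLen w D.perm D.mid i =
      (∑ k, pathLen w D.perm D.mid k) * D'.endpoint s.opp i

theorem Leads.compatible {s : Side} {w : List RauzyKind} {D D' : BlockData} (H : Leads s w D D')
    (hirr : ∀ u, Rauzy.crit (Rauzy.moves u D.perm) ≠ 3) (h : D.Valid) (h' : D'.Valid) :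
    (D.toBlock h).Compatible s w (D'.toBlock h') := by
  obtain ⟨hw, hp, hf, ⟨he0, he⟩, hm0, hm⟩ := H
  have hS := h.1.2.1.2.toReal_pos
  have hmid : (D.toBlock h).mid.len = (toReal (∑ i, D.mid i))⁻¹ • toRealVec D.mid := rfl
  have hscale {c : GoldenInt} {v v' : Fin 4 → GoldenInt} (hv : ∀ i, v i = c * v' i) :
      toRealVec v = toReal c • toRealVec v' := by
    funext i
    simp [toRealVec, hv]
  refine ⟨hw, hp, fun t h0 h1 => ?_, ⟨_, he0.toReal_pos, ?_⟩,
    ⟨_, mul_pos (inv_pos.2 hS) hm0.toReal_pos, ?_⟩⟩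
  · rw [endpoint_len, hmid, smul_smul]
    exact hf.follows (sub_pos.2 h1) (mul_pos h0 (inv_pos.2 hS))
  · rw [endpoint_len, endpoint_len, ← hscale he, toRealVec_pathLen]; rfl
  · rw [endpoint_len, hmid, ← smul_smul, ← Matrix.mulVec_smul, ← hscale hm, toRealVec_pathLen]
    congr 1
    exact (Rauzy.pathMatrix_mulVec_pathLen w _ hirr).symm

end BlockData

/-- The blocks: the endpoints and the middle points are rotations with lengths in `ℤ[φ]`. Each
endpoint has two intervals of length zero, and the lengths of the other two are in the ratio `φ`. -/
def blockData : Fin 18 → BlockData :=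
  let φ : GoldenInt := ⟨0, 1⟩
  -- `x = φ⁻¹` and `y = φ⁻²` add up to one.
  let x : GoldenInt := ⟨-1, 1⟩
  let y : GoldenInt := ⟨2, -1⟩
  ![
  ⟨[], ![0, x, 0, y], ![0, 1, φ, 0], ![x, 0, 0, y]⟩,
  ⟨[], ![0, 0, x, y], ![0, 1, φ, 0], ![x, 0, 0, y]⟩,
  ⟨[], ![0, 0, x, y], ![0, 1, φ, 0], ![x, y, 0, 0]⟩,
  ⟨[], ![0, 0, y, x], ![0, φ, 1, 0], ![y, x, 0, 0]⟩,
  ⟨[], ![y, 0, 0, x], ![0, φ, 1, 0], ![y, x, 0, 0]⟩,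
  ⟨[], ![y, 0, 0, x], ![0, φ, 1, 0], ![y, 0, x, 0]⟩,
  ⟨[.a], ![0, 0, x, y], ![1, φ, 0, 1], ![y, x, 0, 0]⟩,
  ⟨[.a], ![0, 0, x, y], ![1, φ, 0, 1], ![y, 0, x, 0]⟩,
  ⟨[.a], ![0, 0, y, x], ![1, φ, 0, 1], ![x, 0, y, 0]⟩,
  ⟨[.a], ![0, 0, y, x], ![1, φ, 0, 1], ![y, x, 0, 0]⟩,
  ⟨[.b], ![x, 0, 0, y], ![φ, 1, 0, 1], ![0, x, y, 0]⟩,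
  ⟨[.b], ![x, 0, 0, y], ![φ, 1, 0, 1], ![0, y, x, 0]⟩,
  ⟨[.b], ![0, 0, x, y], ![φ, 1, 0, 1], ![0, y, x, 0]⟩,
  ⟨[.b], ![0, 0, y, x], ![φ, 1, 0, 1], ![0, x, y, 0]⟩,
  ⟨[.a, .a], ![y, 0, 0, x], ![φ, 1, 0, φ], ![y, x, 0, 0]⟩,
  ⟨[.a, .b], ![0, 0, x, y], ![1, φ, 0, 0], ![x, 0, 0, y]⟩,
  ⟨[.b, .a], ![0, y, x, 0], ![φ, 0, 1, 0], ![0, y, 0, x]⟩,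
  ⟨[.b, .b], ![0, x, 0, y], ![0, 1, φ, φ], ![0, 0, x, y]⟩]

/-- The Rauzy steps through which the left and the right half of a block lead to the next block. -/
def nextWord : Side → Fin 18 → List RauzyKind
  | .L => ![[.b, .a], [.b], [.b], [.b], [.b], [.b], [.b, .a, .b], [.b, .a, .b], [.b, .b],
      [.b, .b], [.b, .b, .a, .a, .a], [.b, .b, .a, .a, .a], [.b, .a, .b], [.b, .b],
      [.b, .a, .a, .a], [.a, .b], [.a, .b, .b], [.b, .b, .a]]
  | .R => ![[.a], [.a], [.a], [.a], [.a], [.a, .b], [.a, .a, .b, .b, .b], [.a, .b, .a],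
      [.a, .a], [.a, .a, .b, .b, .b], [.a, .a], [.a, .b, .a], [.a, .b, .a], [.a, .a],
      [.a, .a, .b], [.b, .a, .a], [.b, .a], [.a, .b, .b, .b]]

/-- The left and the right compatible block. -/
def next : Side → Fin 18 → Fin 18
  | .L => ![16, 12, 12, 13, 10, 10, 6, 6, 6, 6, 4, 4, 2, 2, 14, 6, 0, 16]
  | .R => ![9, 9, 8, 7, 7, 15, 1, 3, 3, 1, 11, 11, 11, 11, 15, 5, 11, 17]

/-- The matrices of the words `nextWord`. -/
def nextMatrix : Side → Fin 18 → Matrix (Fin 4) (Fin 4) ℕ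
  | .L => ![!![1, 0, 0, 0; 0, 1, 1, 0; 0, 0, 0, 1; 1, 0, 1, 0],
      !![1, 0, 0, 0; 0, 1, 0, 0; 0, 0, 1, 0; 1, 0, 0, 1],
      !![1, 0, 0, 0; 0, 1, 0, 0; 0, 0, 1, 0; 1, 0, 0, 1],
      !![1, 0, 0, 0; 0, 1, 0, 0; 0, 0, 1, 0; 1, 0, 0, 1],
      !![1, 0, 0, 0; 0, 1, 0, 0; 0, 0, 1, 0; 1, 0, 0, 1],
      !![1, 0, 0, 0; 0, 1, 0, 0; 0, 0, 1, 0; 1, 0, 0, 1],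
      !![1, 0, 0, 0; 0, 1, 0, 0; 0, 0, 2, 1; 1, 0, 1, 1],
      !![1, 0, 0, 0; 0, 1, 0, 0; 0, 0, 2, 1; 1, 0, 1, 1],
      !![1, 0, 0, 0; 0, 1, 0, 0; 0, 0, 1, 0; 1, 0, 1, 1],
      !![1, 0, 0, 0; 0, 1, 0, 0; 0, 0, 1, 0; 1, 0, 1, 1],
      !![1, 1, 1, 1; 0, 1, 0, 0; 0, 0, 1, 0; 0, 1, 1, 1],
      !![1, 1, 1, 1; 0, 1, 0, 0; 0, 0, 1, 0; 0, 1, 1, 1],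
      !![1, 0, 0, 0; 0, 1, 0, 0; 0, 0, 2, 1; 0, 1, 1, 1],
      !![1, 0, 0, 0; 0, 1, 0, 0; 0, 0, 1, 0; 0, 1, 1, 1],
      !![1, 1, 1, 1; 0, 1, 0, 0; 0, 0, 1, 0; 1, 1, 1, 2],
      !![1, 0, 0, 0; 0, 1, 0, 0; 0, 0, 2, 1; 0, 0, 1, 1],
      !![1, 0, 0, 0; 0, 1, 1, 0; 0, 1, 1, 1; 0, 0, 1, 0],
      !![1, 0, 0, 0; 0, 1, 1, 0; 0, 0, 0, 1; 1, 0, 1, 1]]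
  | .R => ![!![1, 1, 0, 0; 0, 0, 1, 0; 0, 0, 0, 1; 0, 1, 0, 0],
      !![1, 1, 0, 0; 0, 0, 1, 0; 0, 0, 0, 1; 0, 1, 0, 0],
      !![1, 1, 0, 0; 0, 0, 1, 0; 0, 0, 0, 1; 0, 1, 0, 0],
      !![1, 1, 0, 0; 0, 0, 1, 0; 0, 0, 0, 1; 0, 1, 0, 0],
      !![1, 1, 0, 0; 0, 0, 1, 0; 0, 0, 0, 1; 0, 1, 0, 0],
      !![1, 1, 0, 0; 0, 0, 1, 0; 1, 0, 0, 1; 0, 1, 0, 0],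
      !![1, 1, 1, 0; 1, 1, 1, 1; 0, 1, 0, 0; 0, 0, 1, 0],
      !![1, 1, 1, 0; 0, 0, 0, 1; 1, 2, 0, 0; 0, 0, 1, 0],
      !![1, 1, 1, 0; 0, 0, 0, 1; 0, 1, 0, 0; 0, 0, 1, 0],
      !![1, 1, 1, 0; 1, 1, 1, 1; 0, 1, 0, 0; 0, 0, 1, 0],
      !![1, 0, 0, 0; 0, 1, 1, 1; 0, 0, 1, 0; 0, 0, 0, 1],
      !![1, 0, 0, 0; 0, 1, 1, 1; 0, 1, 2, 0; 0, 0, 0, 1],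
      !![1, 0, 0, 0; 0, 1, 1, 1; 0, 1, 2, 0; 0, 0, 0, 1],
      !![1, 0, 0, 0; 0, 1, 1, 1; 0, 0, 1, 0; 0, 0, 0, 1],
      !![1, 1, 1, 0; 1, 0, 0, 1; 0, 1, 0, 0; 0, 0, 1, 0],
      !![1, 1, 1, 0; 0, 0, 0, 1; 0, 1, 0, 0; 0, 1, 1, 0],
      !![1, 0, 0, 0; 0, 1, 1, 0; 0, 0, 0, 1; 0, 1, 2, 0],
      !![1, 0, 0, 0; 0, 1, 0, 0; 1, 1, 2, 1; 1, 1, 1, 1]]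

theorem blockData_valid : ∀ i, (blockData i).Valid := by
  unfold BlockData.Valid
  decide +kernel

/-- Each half of a block spans the block `next s i`: its ends follow the word `nextWord s i` to the
ends of that block. -/
theorem leads_next : ∀ s i, BlockData.Leads s (nextWord s i) (blockData i) (blockData (next s i)) := by
  unfold BlockData.Leads
  decide +kernel

theorem pathMatrix_nextWord : ∀ s i,
    Rauzy.pathMatrix (nextWord s i) (blockData i).perm = nextMatrix s i := by
  decide +kernel

theorem blockData_injective : ∀ i j, (blockData i).perm = (blockData j).perm →
    (blockData i).left = (blockData j).left → (blockData i).right = (blockData j).right → i = j := by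
  decide +kernel

theorem exists_perm_eq_move : ∀ i t, ∃ j, (blockData j).perm = Rauzy.move t (blockData i).perm := by
  decide +kernel

theorem crit_perm_ne : ∀ i, Rauzy.crit (blockData i).perm ≠ 3 := by
  decide +kernel

/-! ### Block sequences as walks -/

/-- The building block with the index `i`. -/
noncomputable def block (i : Fin 18) : BuildingBlock := (blockData i).toBlock (blockData_valid i)

theorem exists_perm_eq_moves (w : List RauzyKind) (i : Fin 18) :
    ∃ j, (blockData j).perm = Rauzy.moves w (blockData i).perm := by
  induction w generalizing i with
  | nil => exact ⟨i, rfl⟩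
  | cons t w ih =>
    obtain ⟨j, hj⟩ := exists_perm_eq_move i t
    rw [Rauzy.moves, ← hj]
    exact ih j

theorem crit_moves_ne (i : Fin 18) (w : List RauzyKind) :
    Rauzy.crit (Rauzy.moves w (block i).perm) ≠ 3 := by
  obtain ⟨j, hj⟩ := exists_perm_eq_moves w i
  exact hj ▸ crit_perm_ne j

theorem block_separated (i : Fin 18) : (block i).Separated := BlockData.separated _ _

theorem block_compatible_next (s : Side) (i : Fin 18) :
    (block i).Compatible s (nextWord s i) (block (next s i)) :=
  (leads_next s i).compatible (crit_moves_ne i) _ _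

theorem eq_of_block_len_eq {i j : Fin 18} (hp : (block i).perm = (block j).perm)
    (hl : (block i).left.len = (block j).left.len)
    (hr : (block i).right.len = (block j).right.len) : i = j := by
  have inj {u v : Fin 4 → GoldenInt} (h : toRealVec u = toRealVec v) : u = v :=
    funext fun k => toReal_injective (congrFun h k)
  have len (i : Fin 18) (s : Side) := BlockData.endpoint_len _ (blockData_valid i) s
  refine blockData_injective i j hp (inj ?_) (inj ?_)
  · exact (len i .L).symm.trans (hl.trans (len j .L))
  · exact (len i .R).symm.trans (hr.trans (len j .R))

theorem block_injective : Function.Injective block := fun i j h =>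
  eq_of_block_len_eq (by rw [h]) (by rw [h]) (by rw [h])

/-- On each side, `nextWord` and `next` give the only compatibility within the set of blocks. -/
theorem eq_next_of_compatible {s : Side} {w : List RauzyKind} {i j : Fin 18}
    (h : (block i).Compatible s w (block j)) : w = nextWord s i ∧ j = next s i := by
  obtain ⟨h1, h2, h3, h4⟩ := h.unique (crit_moves_ne i) (block_compatible_next s i)
    (block_separated _) (block_separated _)
  exact ⟨h1, eq_of_block_len_eq h2 h3 h4⟩

/-- The final index of a walk with given directions. -/
def walkEnd : Fin 18 → List Side → Fin 18
  | i, [] => i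
  | i, s :: ss => walkEnd (next s i) ss

/-- The block steps of a walk with given directions. -/
noncomputable def walk : Fin 18 → List Side → List BlockStep
  | _, [] => []
  | i, s :: ss => ⟨s, nextWord s i, block (next s i)⟩ :: walk (next s i) ss

/-- The matrix of a walk with given directions. -/
def walkMatrix : Fin 18 → List Side → Matrix (Fin 4) (Fin 4) ℕ
  | _, [] => 1
  | i, s :: ss => nextMatrix s i * walkMatrix (next s i) ss

theorem map_side_walk (i : Fin 18) (ss : List Side) : (walk i ss).map BlockStep.side = ss := by
  induction ss generalizing i with
  | nil => rfl
  | cons s ss ih => rw [walk, List.map_cons, ih]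

theorem walk_append (i : Fin 18) (ss tt : List Side) :
    walk i (ss ++ tt) = walk i ss ++ walk (walkEnd i ss) tt := by
  induction ss generalizing i with
  | nil => rfl
  | cons s ss ih => simp only [List.cons_append, walk, walkEnd, ih]

theorem walkMatrix_append (i : Fin 18) (ss tt : List Side) :
    walkMatrix i (ss ++ tt) = walkMatrix i ss * walkMatrix (walkEnd i ss) tt := by
  induction ss generalizing i with
  | nil => simp [walkMatrix, walkEnd]
  | cons s ss ih => simp only [List.cons_append, walkMatrix, walkEnd, ih, Matrix.mul_assoc]

theorem seqMatrix_walk (i : Fin 18) (ss : List Side) :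
    seqMatrix (block i) (walk i ss) = walkMatrix i ss := by
  induction ss generalizing i with
  | nil => rfl
  | cons s ss ih =>
    rw [walk, seqMatrix, walkMatrix, ← pathMatrix_nextWord, ih]
    rfl

theorem IsBlockSeq.mem {B : Set BuildingBlock} {b : BuildingBlock}
    {r : List BlockStep} (h : IsBlockSeq B b r) : b ∈ B := by
  cases r
  exacts [h, h.1]

/-- Block sequences are walks. -/
theorem eq_walk_of_isBlockSeq {i : Fin 18} {r : List BlockStep}
    (h : IsBlockSeq (Set.range block) (block i) r) : r = walk i (r.map BlockStep.side) := by
  induction r generalizing i with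
  | nil => rfl
  | cons s r ih =>
    obtain ⟨-, hc, hr⟩ := h
    obtain ⟨j, hj⟩ := hr.mem
    obtain ⟨side, word, b⟩ := s
    subst hj
    obtain ⟨rfl, rfl⟩ : word = nextWord side i ∧ j = next side i := eq_next_of_compatible hc
    rw [List.map_cons, walk, ← ih hr]

theorem transitivity_blocks : Transitivity (Set.range block) := by
  intro π hπ
  obtain ⟨i, rfl⟩ : ∃ i, (blockData i).perm = π := by
    induction hπ with
    | refl => exact ⟨0, rfl⟩
    | tail _ h ih =>
      obtain ⟨i, rfl⟩ := ih
      obtain ⟨t, rfl⟩ := h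
      exact exists_perm_eq_move i t
  exact ⟨block i, ⟨i, rfl⟩, rfl, block_separated i⟩

theorem completeness_blocks : Completeness (Set.range block) := by
  rintro _ ⟨i, rfl⟩ s
  exact ⟨_, ⟨next s i, rfl⟩, _, block_compatible_next s i⟩

/-! ### Loops of depth zero -/

theorem eq_replicate_of_swaps_eq_zero (s : Side) (ss : List Side) (h : swaps (s :: ss) = 0) :
    s :: ss = List.replicate (ss.length + 1) s := by
  induction ss generalizing s with
  | nil => rfl
  | cons t ss ih =>
    simp only [swaps, Nat.add_eq_zero_iff, ite_eq_left_iff, one_ne_zero, imp_false, not_not] at h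
    obtain ⟨rfl, h⟩ := h
    rw [ih s h]
    simp [List.replicate_succ]

theorem walkEnd_replicate (s : Side) (i : Fin 18) (k : ℕ) :
    walkEnd i (List.replicate k s) = (next s)^[k] i := by
  induction k generalizing i with
  | zero => rfl
  | succ k ih => rw [List.replicate_succ, walkEnd, ih, Function.iterate_succ_apply]

theorem getLast?_walk (i : Fin 18) (ss : List Side) (b : BlockStep)
    (h : (walk i ss).getLast? = some b) : b.next = block (walkEnd i ss) := by
  induction ss generalizing i with
  | nil => simp [walk] at h
  | cons s ss ih =>
    obtain _ | ⟨t, ss⟩ := ss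
    · simp only [walk, List.getLast?_singleton, Option.some.injEq] at h
      rw [← h]; rfl
    · exact ih (next s i) (by simpa [walk] using h)

theorem next_next_of_iterate_eq {s : Side} {i : Fin 18} {k : ℕ} (h : (next s)^[k + 1] i = i) :
    next s (next s i) = i := by
  have key : ∀ s i, next s (next s (next s (next s i))) = next s (next s i) := by decide +kernel
  have h2 : (next s)^[2 * k + 2] i = i := by
    rw [show 2 * k + 2 = (k + 1) + (k + 1) by ring, Function.iterate_add_apply, h, h]
  rw [show 2 * k + 2 = 2 + 2 * k by ring, Function.iterate_add_apply] at h2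
  rw [← h2]
  exact key s _

/-- A loop of depth zero runs around a cycle of `next s`, and these cycles have length at
most two. -/
theorem exists_eq_walk_of_isBlockLoop {b : BuildingBlock} {r : List BlockStep}
    (h : IsBlockLoop (Set.range block) b r) (hd : seqDepth r = 0) :
    ∃ i s k, b = block i ∧ r = walk i (List.replicate (k + 1) s) ∧ (next s)^[k + 1] i = i ∧
      next s (next s i) = i := by
  obtain ⟨hseq, t, ht, hb⟩ := h
  obtain ⟨i, rfl⟩ := hseq.mem
  have hr := eq_walk_of_isBlockSeq hseq
  obtain _ | ⟨s, r⟩ := r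
  · simp at ht
  have hrep := eq_replicate_of_swaps_eq_zero s.side (r.map BlockStep.side) hd
  rw [List.map_cons, hrep] at hr
  rw [hr] at ht
  have hend := getLast?_walk _ _ _ ht
  rw [hb, walkEnd_replicate] at hend
  have hcyc := (block_injective hend).symm
  exact ⟨i, s.side, _, rfl, hr, hcyc, next_next_of_iterate_eq hcyc⟩

namespace Matrix4

variable {M N : Matrix (Fin 4) (Fin 4) ℕ} {A P : Finset (Fin 4)}

-- Instance search for predicates on two indices does not unfold `Matrix` to find this instance.
instance (M : Matrix (Fin 4) (Fin 4) ℕ) (i j : Fin 4) : Decidable (0 < M i j) := Nat.decLt _ _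

instance : Decidable (IsGrouping M A P) :=
  decidable_of_iff (Disjoint A P ∧ 2 ≤ A.card ∧ (A ∪ P)ᶜ.card ≤ 1 ∧
    (∀ i j, i ≠ j → 0 < M i j → i ∈ A) ∧ (∀ i ∈ A, ∀ j ∈ A, i ≠ j → 0 < M i j) ∧
    ∀ j ∈ P, ∃ i ∈ A, 0 < M i j)
    ⟨fun ⟨h1, h2, h3, h4, h5, h6⟩ => ⟨h1, h2, h3, h4, h5, h6⟩,
      fun h => ⟨h.1, h.2, h.3, h.4, h.5, h.6⟩⟩

/-- The columns that are added to some other column. -/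
def active (M : Matrix (Fin 4) (Fin 4) ℕ) : Finset (Fin 4) := {i | ∃ j, i ≠ j ∧ 0 < M i j}

/-- The remaining columns to which another column is added. -/
def passive (M : Matrix (Fin 4) (Fin 4) ℕ) : Finset (Fin 4) :=
  {j | j ∉ active M ∧ ∃ i ∈ active M, 0 < M i j}

/-- `M` is combining with the group `A` of active columns, all other columns are passive, and in
addition its diagonal is positive. In contrast to the existence of a grouping without idle columns,
this is inherited by products. -/
structure IsFull (A : Finset (Fin 4)) (M : Matrix (Fin 4) (Fin 4) ℕ) : Prop where
  two_le : 2 ≤ A.card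
  diag : ∀ i, 0 < M i i
  inactive : ∀ i ∉ A, ∀ j, i ≠ j → ¬ 0 < M i j
  active_active : ∀ i ∈ A, ∀ j ∈ A, 0 < M i j
  passive : ∀ j ∉ A, ∃ i ∈ A, 0 < M i j

instance : Decidable (IsFull A M) :=
  decidable_of_iff (2 ≤ A.card ∧ (∀ i, 0 < M i i) ∧ (∀ i ∉ A, ∀ j, i ≠ j → ¬ 0 < M i j) ∧
    (∀ i ∈ A, ∀ j ∈ A, 0 < M i j) ∧ ∀ j ∉ A, ∃ i ∈ A, 0 < M i j)
    ⟨fun ⟨h1, h2, h3, h4, h5⟩ => ⟨h1, h2, h3, h4, h5⟩, fun h => ⟨h.1, h.2, h.3, h.4, h.5⟩⟩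

theorem mul_apply_pos {i j k : Fin 4} (h1 : 0 < M i j) (h2 : 0 < N j k) : 0 < (M * N) i k := by
  rw [Matrix.mul_apply]
  exact Finset.sum_pos' (fun _ _ => Nat.zero_le _) ⟨j, Finset.mem_univ _, Nat.mul_pos h1 h2⟩

theorem IsFull.mul (hM : IsFull A M) (hN : IsFull A N) : IsFull A (M * N) where
  two_le := hM.two_le
  diag i := mul_apply_pos (hM.diag i) (hN.diag i)
  inactive i hi j hij := by
    rw [Nat.pos_iff_ne_zero, not_not, Matrix.mul_apply]
    refine Finset.sum_eq_zero fun k _ => ?_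
    by_cases hk : i = k
    · rw [← hk, Nat.eq_zero_of_not_pos (hN.inactive i hi j hij), mul_zero]
    · rw [Nat.eq_zero_of_not_pos (hM.inactive i hi k hk), zero_mul]
  active_active i hi j hj := mul_apply_pos (hM.active_active i hi j hj) (hN.diag j)
  passive j hj := by
    obtain ⟨i, hi, hij⟩ := hM.passive j hj
    exact ⟨i, hi, mul_apply_pos hij (hN.diag j)⟩

theorem IsFull.pow (hM : IsFull A M) (k : ℕ) : IsFull A (M ^ (k + 1)) := by
  induction k with
  | zero => simpa using hM
  | succ k ih => rw [pow_succ]; exact ih.mul hM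

theorem IsFull.isGrouping (hM : IsFull A M) : IsGrouping M A Aᶜ where
  disjoint := disjoint_compl_right
  two_le := hM.two_le
  idle_le := by simp
  only_active i j hij h := by
    by_contra hi
    exact hM.inactive i hi j hij h
  active_active i hi j hj _ := hM.active_active i hi j hj
  passive j hj := hM.passive j (by simpa using hj)

theorem IsFull.not_isIdle (hM : IsFull A M) (i : Fin 4) : ¬ IsIdle M i := fun h => by
  simpa using h.2 A Aᶜ hM.isGrouping

theorem diag_pow_pos (h : ∀ i, 0 < M i i) (k : ℕ) (i : Fin 4) : 0 < (M ^ k) i i := by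
  induction k with
  | zero => simp
  | succ k ih => rw [pow_succ]; exact mul_apply_pos ih (h i)

end Matrix4

theorem isGrouping_of_fixed : ∀ s i, next s i = i →
    Matrix4.IsGrouping (nextMatrix s i) (Matrix4.active (nextMatrix s i))
      (Matrix4.passive (nextMatrix s i)) := by
  decide +kernel

theorem isFull_of_period_two : ∀ s i, next s i ≠ i → next s (next s i) = i →
    Matrix4.IsFull (Matrix4.active (nextMatrix s i * nextMatrix s (next s i)))
      (nextMatrix s i * nextMatrix s (next s i)) := by
  decide +kernel

/-- Of the loops of depth zero that consist of one block, all but two have no idle column. -/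
theorem isFull_of_fixed : ∀ s i, next s i = i → (s = .L ∧ i = 6) ∨ (s = .R ∧ i = 11) ∨
    Matrix4.IsFull (Matrix4.active (nextMatrix s i)) (nextMatrix s i) := by
  decide +kernel

theorem combiningLoops_blocks : CombiningLoops (Set.range block) := by
  intro b r hloop hd hnd
  obtain ⟨i, s, k, rfl, rfl, hcyc, h2⟩ := exists_eq_walk_of_isBlockLoop hloop hd
  rw [seqMatrix_walk]
  match k, hcyc, hnd with
  | 0, hcyc, _ =>
    rw [List.replicate_succ, walkMatrix, List.replicate_zero, walkMatrix, mul_one]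
    exact ⟨_, _, isGrouping_of_fixed s i hcyc⟩
  | 1, _, hnd =>
    simp only [List.replicate_succ, List.replicate_zero, walkMatrix, mul_one]
    refine ⟨_, _, (isFull_of_period_two s i (fun h => ?_) h2).isGrouping⟩
    simp [loopBlocks, List.replicate_succ, walk, h] at hnd
  | k + 2, _, hnd =>
    simp [loopBlocks, List.replicate_succ, walk, h2] at hnd

theorem walkMatrix_replicate_of_fixed {s : Side} {i : Fin 18} (h : next s i = i) (k : ℕ) :
    walkMatrix i (List.replicate k s) = nextMatrix s i ^ k := by
  induction k with
  | zero => rfl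
  | succ k ih => rw [List.replicate_succ, walkMatrix, h, ih, pow_succ']

theorem walkMatrix_replicate_of_period_two {s : Side} {i : Fin 18} (h : next s (next s i) = i)
    (k : ℕ) : walkMatrix i (List.replicate (2 * k) s) =
      (nextMatrix s i * nextMatrix s (next s i)) ^ k := by
  induction k with
  | zero => rfl
  | succ k ih =>
    rw [mul_add, mul_one, List.replicate_succ, List.replicate_succ, walkMatrix, walkMatrix, h, ih,
      pow_succ', Matrix.mul_assoc]

/-- The two exceptional loops are left within one step in the other direction, and three steps make
all columns combinations of at least two columns. -/
theorem two_le_card_of_leaves : ∀ s i, (s = .L ∧ i = 6) ∨ (s = .R ∧ i = 11) →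
    (∀ j, 0 < nextMatrix s i j j) ∧ ∀ e₁ e₂ e₃, next e₁ i ≠ i →
      ∀ j, 2 ≤ (Finset.univ.filter fun k => walkMatrix i [e₁, e₂, e₃] k j ≠ 0).card := by
  decide +kernel

theorem isolatedIdle_blocks : IsolatedIdle (Set.range block) := by
  rintro b r hloop hd ⟨c, hc⟩ s₁ s₂ s₃ hseq hleave j
  obtain ⟨i, s, k, rfl, rfl, hcyc, h2⟩ := exists_eq_walk_of_isBlockLoop hloop hd
  rw [seqMatrix_walk] at hc
  obtain ⟨hfix, hspecial⟩ : next s i = i ∧ ((s = .L ∧ i = 6) ∨ (s = .R ∧ i = 11)) := by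
    by_cases hfix : next s i = i
    · refine ⟨hfix, ?_⟩
      rcases isFull_of_fixed s i hfix with h | h | h
      · exact .inl h
      · exact .inr h
      · rw [walkMatrix_replicate_of_fixed hfix] at hc
        exact absurd hc ((h.pow k).not_isIdle c)
    · exfalso
      rcases Nat.even_or_odd' (k + 1) with ⟨m, hm | hm⟩
      · obtain _ | m := m
        · simp at hm
        rw [hm, walkMatrix_replicate_of_period_two h2] at hc
        exact ((isFull_of_period_two s i hfix h2).pow m).not_isIdle c hc
      · have : (next s)^[2 * m] i = i := by
          rw [Function.iterate_mul]
          exact Function.iterate_fixed h2 m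
        rw [hm, Function.iterate_succ_apply', this] at hcyc
        exact hfix hcyc
  have hend (m : ℕ) : walkEnd i (List.replicate m s) = i := by
    rw [walkEnd_replicate]; exact Function.iterate_fixed hfix m
  have hsplit : walk i (List.replicate (k + 1) s) =
      walk i (List.replicate k s) ++ [⟨s, nextWord s i, block i⟩] := by
    rw [List.replicate_succ', walk_append, hend]
    simp [walk, hfix]
  have hblocks (m : ℕ) : (walk i (List.replicate m s)).map BlockStep.next =
      List.replicate m (block i) := by
    induction m with
    | zero => rfl
    | succ m ih => rw [List.replicate_succ, walk, hfix, List.map_cons, ih]; rfl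
  have hP : loopBlocks (block i) (walk i (List.replicate (k + 1) s)) =
      (List.replicate (k + 1) [block i]).flatten := by
    rw [loopBlocks, hsplit, List.dropLast_concat, hblocks]
    simp [List.replicate_succ]
  have hne := hleave.1 _ _ hP
  rw [hsplit, List.dropLast_concat] at hseq ⊢
  have hw := eq_walk_of_isBlockSeq hseq
  rw [List.map_append, map_side_walk, walk_append, hend, List.append_cancel_left_eq] at hw
  have happ (ss : List Side) : walk i (List.replicate k s) ++ walk i ss =
      walk i (List.replicate k s ++ ss) := by rw [walk_append, hend]
  rw [hw, happ, seqMatrix_walk, walkMatrix_append, hend,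
    walkMatrix_replicate_of_fixed hfix]
  obtain ⟨hdiag, hcols⟩ := two_le_card_of_leaves s i hspecial
  refine (hcols s₁.side s₂.side s₃.side (fun h => hne ?_) j).trans
    (Finset.card_le_card fun m hm => ?_)
  · simp only [List.map_cons, List.map_nil, walk, List.cons.injEq] at hw
    rw [hw.1, h]
    simp
  · simp only [Finset.mem_filter, Finset.mem_univ, true_and] at hm ⊢
    exact (Matrix4.mul_apply_pos (Matrix4.diag_pow_pos hdiag k m) (Nat.pos_of_ne_zero hm)).ne'

/-! ### Almost positivity -/

theorem swaps_cons_cons (s t : Side) (ss : List Side) :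
    swaps (s :: t :: ss) = (if s = t then 0 else 1) + swaps (t :: ss) := rfl

theorem swaps_le_swaps_cons (s : Side) (ss : List Side) : swaps ss ≤ swaps (s :: ss) := by
  cases ss
  · exact le_rfl
  · exact Nat.le_add_left _ _

/-- The direction after the steps `ss`, if the direction before them is `s`. -/
def lastSide : Side → List Side → Side
  | s, [] => s
  | _, t :: ss => lastSide t ss

theorem swaps_cons_append (s : Side) (ss tt : List Side) :
    swaps (s :: (ss ++ tt)) = swaps (s :: ss) + swaps (lastSide s ss :: tt) := by
  induction ss generalizing s with
  | nil => simp [swaps, lastSide]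
  | cons t ss ih => rw [List.cons_append, swaps_cons_cons, swaps_cons_cons, ih, lastSide, add_assoc]

theorem exists_append_swaps_eq {n : ℕ} {s : Side} {ss : List Side} (h : n ≤ swaps (s :: ss)) :
    ∃ tt uu, ss = tt ++ uu ∧ swaps (s :: tt) = n := by
  induction ss generalizing s n with
  | nil => exact ⟨[], [], rfl, (Nat.le_zero.1 h).symm⟩
  | cons t ss ih =>
    obtain _ | n := n
    · exact ⟨[], _, rfl, rfl⟩
    rw [swaps_cons_cons] at h
    by_cases hst : s = t
    · rw [if_pos hst, zero_add] at h
      obtain ⟨tt, uu, rfl, hs⟩ := ih h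
      exact ⟨t :: tt, uu, rfl, by rw [swaps_cons_cons, if_pos hst, zero_add, hs]⟩
    · rw [if_neg hst] at h
      obtain ⟨tt, uu, rfl, hs⟩ := ih (n := n) (s := t) (by omega)
      exact ⟨t :: tt, uu, rfl, by rw [swaps_cons_cons, if_neg hst, add_comm, hs]⟩

/-- `v` is the `j`-th row of the identity matrix. -/
def IsUnitRowAt (v : Fin 4 → ℕ) (j : Fin 4) : Prop := v j = 1 ∧ ∀ j', j' ≠ j → v j' = 0

/-- `v` is a row of the identity matrix. -/
def IsUnitRow (v : Fin 4 → ℕ) : Prop := ∃ j, IsUnitRowAt v j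

-- As above, the instances are stated for the rows of a matrix.
instance (M : Matrix (Fin 4) (Fin 4) ℕ) (i j : Fin 4) : Decidable (IsUnitRowAt (M i) j) :=
  inferInstanceAs (Decidable (_ ∧ _))

instance (M : Matrix (Fin 4) (Fin 4) ℕ) (i : Fin 4) : Decidable (IsUnitRow (M i)) :=
  inferInstanceAs (Decidable (∃ j, IsUnitRowAt (M i) j))

theorem IsUnitRowAt.vecMul {v : Fin 4 → ℕ} {j : Fin 4} (h : IsUnitRowAt v j)
    (M : Matrix (Fin 4) (Fin 4) ℕ) : v ᵥ* M = M j := by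
  obtain rfl : v = Pi.single j 1 := by
    funext k
    by_cases hk : k = j
    · rw [hk, h.1, Pi.single_eq_same]
    · rw [h.2 k hk, Pi.single_eq_of_ne hk]
  exact Matrix.single_one_vecMul j M

theorem vecMul_pos {v : Fin 4 → ℕ} {M : Matrix (Fin 4) (Fin 4) ℕ} {i j : Fin 4} (hi : 0 < v i)
    (h : 0 < M i j) : 0 < (v ᵥ* M) j :=
  Finset.sum_pos' (f := fun i => v i * M i j) (fun _ _ => Nat.zero_le _)
    ⟨i, Finset.mem_univ _, Nat.mul_pos hi h⟩

/-- The positions at which `v ᵥ* M` is positive whenever `v` is positive on `m`. -/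
def spread (M : Matrix (Fin 4) (Fin 4) ℕ) (m : Finset (Fin 4)) : Finset (Fin 4) :=
  {j | ∃ i ∈ m, 0 < M i j}

theorem vecMul_pos_of_mem_spread {v : Fin 4 → ℕ} {M : Matrix (Fin 4) (Fin 4) ℕ}
    {m : Finset (Fin 4)} (hv : ∀ i ∈ m, 0 < v i) {j : Fin 4} (hj : j ∈ spread M m) :
    0 < (v ᵥ* M) j := by
  obtain ⟨i, hi, hij⟩ : ∃ i ∈ m, 0 < M i j := by simpa [spread] using hj
  exact vecMul_pos (hv i hi) hij

/-- The possible supports of a row of the matrix of a walk that ends at the block `i` with the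
direction `s` and that is neither a row of the identity nor positive; each with a bound for the
number of further changes of direction before the row becomes positive. -/
def supports : Side → Fin 18 → List (Finset (Fin 4) × ℕ)
  | .L => ![[({1, 2}, 5), ({1, 2, 3}, 1)],
      [],
      [({0, 1}, 2), ({0, 1, 2}, 0), ({2, 3}, 3), ({1, 2, 3}, 1)],
      [],
      [({1, 2}, 4), ({1, 2, 3}, 1)],
      [],
      [({0, 1}, 0), ({0, 1, 2}, 0), ({2, 3}, 5), ({0, 2, 3}, 2)],
      [],
      [],
      [],
      [({1, 2}, 4), ({0, 1, 2}, 0), ({0, 3}, 1)],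
      [],
      [({0, 1}, 2), ({1, 2}, 3), ({0, 1, 2}, 0), ({0, 3}, 1), ({0, 2, 3}, 0)],
      [({0, 1}, 2), ({0, 1, 2}, 0), ({0, 3}, 1), ({0, 2, 3}, 1)],
      [],
      [],
      [({0, 2}, 1), ({1, 2}, 3), ({0, 2, 3}, 0), ({1, 2, 3}, 3)],
      []]
  | .R => ![[],
      [({1, 2}, 4), ({0, 1, 2}, 1)],
      [],
      [({0, 1}, 3), ({0, 1, 2}, 1), ({2, 3}, 2), ({1, 2, 3}, 0)],
      [],
      [({1, 2}, 5), ({0, 1, 2}, 1)],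
      [],
      [({0, 1}, 1), ({0, 1, 2}, 0), ({1, 3}, 2), ({2, 3}, 3), ({1, 2, 3}, 0)],
      [({0, 1}, 1), ({0, 1, 2}, 1), ({1, 3}, 2), ({1, 2, 3}, 0)],
      [({0, 1}, 1), ({2, 3}, 4), ({1, 2, 3}, 0)],
      [],
      [({1, 2}, 5), ({0, 3}, 0), ({0, 2, 3}, 0), ({1, 2, 3}, 2)],
      [],
      [],
      [],
      [({0, 1}, 1), ({0, 1, 2}, 0), ({0, 3}, 3), ({0, 2, 3}, 3)],
      [],
      []]

/-- Along a walk the support of a row that has been recorded in `supports` either becomes full or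
contains a recorded one again, with one fewer change of direction left whenever the direction has
changed. -/
theorem supports_step : ∀ s i, ∀ p ∈ supports s i, ∀ e,
    (∀ j, j ∈ spread (nextMatrix e i) p.1) ∨ ∃ q ∈ supports e (next e i),
      q.1 ⊆ spread (nextMatrix e i) p.1 ∧ (if s = e then 0 else 1) + q.2 ≤ p.2 := by
  decide +kernel

theorem supports_of_row : ∀ e i j, IsUnitRow (nextMatrix e i j) ∨
    (∀ k, 0 < nextMatrix e i j k) ∨
      ∃ q ∈ supports e (next e i), ∀ k ∈ q.1, 0 < nextMatrix e i j k := by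
  decide +kernel

theorem supports_bounds : ∀ s i, ∀ p ∈ supports s i, 2 ≤ p.1.card ∧ p.2 < 6 := by
  decide +kernel

theorem exists_nextMatrix_pos : ∀ s i j, ∃ k, 0 < nextMatrix s i k j := by
  decide +kernel

/-- The row `v` is positive, or positive on one of the sets that the list `supports` provides. -/
def IsGrown (s : Side) (i : Fin 18) (v : Fin 4 → ℕ) : Prop :=
  (∀ k, 0 < v k) ∨ ∃ q ∈ supports s i, ∀ k ∈ q.1, 0 < v k

theorem IsGrown.not_isUnitRow {s : Side} {i : Fin 18} {v : Fin 4 → ℕ} (h : IsGrown s i v) :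
    ¬ IsUnitRow v := by
  rintro ⟨j, -, hj⟩
  rcases h with h | ⟨q, hq, h⟩
  · have (k : Fin 4) : k = j := by
      by_contra hk
      exact (h k).ne' (hj k hk)
    exact absurd ((this 0).trans (this 1).symm) (by decide)
  · obtain ⟨k, hk, hkj⟩ := Finset.exists_mem_ne (supports_bounds s i q hq).1 j
    exact (h k hk).ne' (hj k hkj)

theorem vecMul_walkMatrix_pos {v : Fin 4 → ℕ} (h : ∀ k, 0 < v k) (i : Fin 18) (ss : List Side)
    (j : Fin 4) : 0 < (v ᵥ* walkMatrix i ss) j := by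
  induction ss generalizing i v with
  | nil => simpa [walkMatrix] using h j
  | cons e ss ih =>
    rw [walkMatrix, ← Matrix.vecMul_vecMul]
    refine ih (fun k => ?_) _
    obtain ⟨l, hl⟩ := exists_nextMatrix_pos e i k
    exact vecMul_pos (h l) hl

theorem IsGrown.vecMul_walkMatrix {s : Side} {i : Fin 18} {v : Fin 4 → ℕ} (h : IsGrown s i v)
    (ss : List Side) :
    IsGrown (lastSide s ss) (walkEnd i ss) (v ᵥ* walkMatrix i ss) := by
  induction ss generalizing s i v with
  | nil => simpa [walkMatrix, lastSide, walkEnd] using h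
  | cons e ss ih =>
    rcases h with h | ⟨q, hq, h⟩
    · exact .inl (vecMul_walkMatrix_pos h _ _)
    rw [walkMatrix, ← Matrix.vecMul_vecMul]
    refine ih ?_
    rcases supports_step s i q hq e with h' | ⟨q', hq', hsub, -⟩
    · exact .inl fun k => vecMul_pos_of_mem_spread h (h' k)
    · exact .inr ⟨q', hq', fun k hk => vecMul_pos_of_mem_spread h (hsub hk)⟩

theorem vecMul_walkMatrix_pos_of_lt {s : Side} {i : Fin 18} {v : Fin 4 → ℕ}
    {p : Finset (Fin 4) × ℕ} (hp : p ∈ supports s i) (hv : ∀ k ∈ p.1, 0 < v k) {ss : List Side}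
    (hss : p.2 < swaps (s :: ss)) (j : Fin 4) : 0 < (v ᵥ* walkMatrix i ss) j := by
  induction ss generalizing s i v p with
  | nil => exact absurd hss (Nat.not_lt_zero _)
  | cons e ss ih =>
    rw [walkMatrix, ← Matrix.vecMul_vecMul]
    rcases supports_step s i p hp e with h | ⟨q, hq, hsub, hle⟩
    · exact vecMul_walkMatrix_pos (fun k => vecMul_pos_of_mem_spread hv (h k)) _ _ _
    · refine ih hq (fun k hk => vecMul_pos_of_mem_spread hv (hsub hk)) ?_
      rw [swaps_cons_cons] at hss
      omega

/-- A row that has ceased to be a row of the identity becomes positive after at most six changes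
of direction. -/
theorem IsGrown.vecMul_pos {s : Side} {i : Fin 18} {v : Fin 4 → ℕ} (h : IsGrown s i v)
    {ss : List Side} (hss : 6 ≤ swaps (s :: ss)) (j : Fin 4) : 0 < (v ᵥ* walkMatrix i ss) j := by
  rcases h with h | ⟨q, hq, h⟩
  · exact vecMul_walkMatrix_pos h _ _ _
  · exact vecMul_walkMatrix_pos_of_lt hq h ((supports_bounds s i q hq).2.trans_le hss) j

theorem isUnitRow_or_isGrown_vecMul {s : Side} {i : Fin 18} {v : Fin 4 → ℕ}
    (h : IsUnitRow v ∨ IsGrown s i v) (ss : List Side) :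
    IsUnitRow (v ᵥ* walkMatrix i ss) ∨
      IsGrown (lastSide s ss) (walkEnd i ss) (v ᵥ* walkMatrix i ss) := by
  induction ss generalizing s i v with
  | nil => simpa [walkMatrix, lastSide, walkEnd] using h
  | cons e ss ih =>
    rcases h with ⟨j, h⟩ | h
    · rw [walkMatrix, ← Matrix.vecMul_vecMul]
      refine ih ?_
      rw [h.vecMul]
      exact supports_of_row e i j
    · exact .inr (h.vecMul_walkMatrix _)

/-- A number of changes of direction after which at least one of the three rows `j ≠ k` is not a
row of the identity any more, for a walk that starts at the block `i` after the direction `s`. -/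
def delay : Side → Fin 18 → Fin 4 → ℕ
  | .L, i, k => if k = 0 ∧ i ∈ [0, 1, 2, 3, 4, 8] ∨ k = 1 ∧ i ∈ [10, 13] then 2 else 1
  | .R, i, k => if k = 3 ∧ i ∈ [1, 2, 3, 4, 5, 8, 9, 13] then 2 else 1

/-- If all rows other than the row `k` are still rows of the identity after a step, then some `k'`
takes over the role of `k`: each `j' ≠ k'` is the position of the entry `1` in one of those rows. A
change of direction in the step uses up one unit of `delay`. -/
theorem delay_step : ∀ s i k e, (∃ j, j ≠ k ∧ ¬ IsUnitRow (nextMatrix e i j)) ∨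
    ∃ k', (if s = e then 0 else 1) + delay e (next e i) k' ≤ delay s i k ∧
      ∀ j', j' ≠ k' → ∃ j, j ≠ k ∧ IsUnitRowAt (nextMatrix e i j) j' := by
  decide +kernel

theorem delay_bounds (s : Side) (i : Fin 18) (k : Fin 4) : 0 < delay s i k ∧ delay s i k ≤ 2 := by
  cases s <;> simp only [delay] <;> split_ifs <;> decide

theorem exists_not_isUnitRow {s : Side} {i : Fin 18} {k : Fin 4} {ss : List Side}
    (h : delay s i k ≤ swaps (s :: ss)) : ∃ j, j ≠ k ∧ ¬ IsUnitRow (walkMatrix i ss j) := by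
  induction ss generalizing s i k with
  | nil => exact absurd h (not_le.2 (delay_bounds s i k).1)
  | cons e ss ih =>
    have hrow (j : Fin 4) : walkMatrix i (e :: ss) j =
        nextMatrix e i j ᵥ* walkMatrix (next e i) ss := rfl
    rcases delay_step s i k e with ⟨j, hj, hu⟩ | ⟨k', hk, H⟩
    · refine ⟨j, hj, ?_⟩
      have : IsGrown e (next e i) (nextMatrix e i j) := (supports_of_row e i j).resolve_left hu
      rw [hrow]
      exact (this.vecMul_walkMatrix ss).not_isUnitRow
    · rw [swaps_cons_cons] at h
      obtain ⟨j', hj', hu⟩ := ih (i := next e i) (k := k') (s := e) (by omega)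
      obtain ⟨j, hj, hs⟩ := H j' hj'
      refine ⟨j, hj, ?_⟩
      rwa [hrow, hs.vecMul]

theorem isUnitRow_one (j : Fin 4) : IsUnitRow ((1 : Matrix (Fin 4) (Fin 4) ℕ) j) :=
  ⟨j, Matrix.one_apply_eq j, fun _ h => Matrix.one_apply_ne h.symm⟩

/-- Every six changes of direction, either all rows that are not rows of the identity are positive,
or the number of rows of the identity has decreased. -/
theorem exists_almostPositive_mul {s : Side} {i : Fin 18} {M : Matrix (Fin 4) (Fin 4) ℕ}
    (hM : ∀ j, IsUnitRow (M j) ∨ IsGrown s i (M j)) (htwo : ∀ k, ∃ j, j ≠ k ∧ ¬ IsUnitRow (M j))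
    {u : ℕ} (hu : (Finset.univ.filter fun j => IsUnitRow (M j)).card ≤ u) {ss : List Side}
    (hss : 6 * (u + 1) ≤ swaps (s :: ss)) :
    ∃ tt, tt <+: ss ∧ swaps (s :: tt) ≤ 6 * (u + 1) ∧
      Matrix4.AlmostPositive (M * walkMatrix i tt) := by
  induction u using Nat.strong_induction_on generalizing s i M ss with
  | _ u ih =>
    obtain ⟨tt, uu, rfl, htt⟩ := exists_append_swaps_eq (n := 6) (s := s) (ss := ss) (by omega)
    have hrow (j : Fin 4) : (M * walkMatrix i tt) j = M j ᵥ* walkMatrix i tt := rfl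
    have hpos (j : Fin 4) (hj : ¬ IsUnitRow (M j)) (k : Fin 4) : 0 < (M * walkMatrix i tt) j k := by
      rw [hrow]
      exact ((hM j).resolve_left hj).vecMul_pos htt.ge k
    have hnot (j : Fin 4) (hj : ¬ IsUnitRow (M j)) : ¬ IsUnitRow ((M * walkMatrix i tt) j) :=
      IsGrown.not_isUnitRow (s := s) (i := i) (.inl (hpos j hj))
    by_cases hall : ∀ j, IsUnitRow (M j) → IsUnitRow ((M * walkMatrix i tt) j)
    · refine ⟨tt, List.prefix_append _ _, by omega,
        Finset.univ.filter fun j => ¬ IsUnitRow (M j), ?_, fun j hj => hpos j (by simpa using hj),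
        fun j hj => hall j (by simpa using hj)⟩
      obtain ⟨j, -, hj⟩ := htwo 0
      obtain ⟨j', hne, hj'⟩ := htwo j
      exact Finset.one_lt_card.2 ⟨j, by simpa using hj, j', by simpa using hj', hne.symm⟩
    · push Not at hall
      obtain ⟨j, hj, hj'⟩ := hall
      have hlt : (Finset.univ.filter fun j => IsUnitRow ((M * walkMatrix i tt) j)).card <
          (Finset.univ.filter fun j => IsUnitRow (M j)).card := by
        refine Finset.card_lt_card ⟨fun l hl => ?_, fun hsub => ?_⟩
        · simp only [Finset.mem_filter, Finset.mem_univ, true_and] at hl ⊢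
          by_contra h
          exact hnot l h hl
        · exact hj' (by simpa using hsub (by simpa using hj))
      obtain _ | u := u
      · omega
      rw [swaps_cons_append, htt] at hss
      obtain ⟨vv, hvv, hs, hap⟩ := ih u (Nat.lt_succ_self u) (s := lastSide s tt)
        (i := walkEnd i tt) (M := M * walkMatrix i tt) (ss := uu)
        (fun j => isUnitRow_or_isGrown_vecMul (hM j) tt)
        (fun k => (htwo k).imp fun j hj => ⟨hj.1, hnot j hj.2⟩) (by omega) (by omega)
      refine ⟨tt ++ vv, (List.prefix_append_right_inj tt).2 hvv, ?_, ?_⟩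
      · rw [swaps_cons_append, htt]
        omega
      · rwa [walkMatrix_append, ← Matrix.mul_assoc]

theorem almostPositivity_blocks : AlmostPositivity (Set.range block) := by
  -- Two changes of direction leave at most two of the four rows of the identity; then the number of
  -- these rows, which is at most four, can decrease at most four times.
  refine ⟨2 + 6 * (4 + 1), fun b r hseq hd => ?_⟩
  obtain ⟨i, rfl⟩ := hseq.mem
  rw [eq_walk_of_isBlockSeq hseq, seqDepth, map_side_walk] at hd
  rw [eq_walk_of_isBlockSeq hseq]
  generalize r.map BlockStep.side = ss at hd ⊢
  have hd' := hd.trans (swaps_le_swaps_cons .L ss)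
  obtain ⟨tt, uu, rfl, htt⟩ := exists_append_swaps_eq (n := 2) (s := .L) (ss := ss) (by omega)
  rw [swaps_cons_append, htt] at hd'
  have hone (j : Fin 4) := isUnitRow_or_isGrown_vecMul (s := .L) (i := i)
    (.inl (isUnitRow_one j)) tt
  simp only [show ∀ j, (1 : Matrix (Fin 4) (Fin 4) ℕ) j ᵥ* walkMatrix i tt = walkMatrix i tt j from
    fun j => congrFun (Matrix.one_mul (walkMatrix i tt)) j] at hone
  obtain ⟨vv, hvv, hs, hap⟩ := exists_almostPositive_mul (u := 4) (ss := uu) hone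
    (fun k => exists_not_isUnitRow ((delay_bounds .L i k).2.trans htt.ge))
    (Finset.card_le_univ _) (by omega)
  obtain ⟨ww, rfl⟩ := hvv
  refine ⟨walk i (tt ++ vv), ?_, ?_, ?_⟩
  · rw [← List.append_assoc, walk_append i (tt ++ vv)]
    exact List.prefix_append _ _
  · rw [seqDepth, map_side_walk]
    refine (swaps_le_swaps_cons .L _).trans ?_
    rw [swaps_cons_append, htt]
    omega
  · rwa [seqMatrix_walk, walkMatrix_append]

theorem mainTheorem3 :
    ∃ B : Set BuildingBlock, B.Finite ∧ Transitivity B ∧ Completeness B ∧ CombiningLoops B ∧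
      IsolatedIdle B ∧ AlmostPositivity B :=
  ⟨Set.range block, Set.finite_range block, transitivity_blocks, completeness_blocks,
    combiningLoops_blocks, isolatedIdle_blocks, almostPositivity_blocks⟩
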